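/- **Model.** A finite linear (path) conflict graph has nodes $1,\dots,M$, with an edge between two nodes iff their numbers differ by one. There are $l$ primaries and $m$ secondaries at each node, $1\le m<l$. Each primary owns one channel. Independently of the other channels, the channel is in state $j\in\{1,\dots,n\}$ at all nodes simultaneously with probability $q_j>0$, where $\sum_{j=1}^n q_j<1$, and with the remaining probability it is unavailable at all nodes (state $0$). A primary knows the state of its own channel only. Admissible prices form an interval $D\subseteq\mathbb R$ containing the transition cost $c$. At price $p\in D$ a channel in state $j$ has penalty $g_j(p)$, where each $g_j$ is strictly increasing on $D$ (and continuous, if $n\ge 2$) and $g_j(p)<g_i(p)$ for $i<j$; let $f_j:g_j(D)\to D$ be the inverse of $g_j$. No secondary accepts a penalty above $v$, where $v\in g_j(D)$ and $v>g_j(c)$ for all $j$. For $i<j$ and all $x>y>g_i(c)$ in $g_i(D)\cap g_j(D)$, $$\frac{f_i(y)-c}{f_j(y)-c}<\frac{f_i(x)-c}{f_j(x)-c}.$$ **Game.** A strategy of a primary gives, for each state $j\in\{1,\dots,n\}$ of its channel, a probability mass function over the independent sets of the graph and, for each node, a probability distribution on the penalties $g_j(D)$ under which the expectation of $f_j(x)\mathbf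 1_{x\le v}$ is finite. The primary offers its channel at all nodes of the selected independent set, at penalties drawn from the distributions of these nodes; primaries act independently of each other. At each node the (at most) $m$ offers of lowest penalty among those with penalty at most $v$ are sold, ties being broken uniformly at random. The payoff at a node is $f_j(x)-c$ if the channel, being in state $j$, is sold there at penalty $x$, and $0$ otherwise; the payoff of a primary is the sum over the nodes of its independent set. A strategy profile is a Nash equilibrium (NE) if in no channel state $j\in\{1,\dots,n\}$ can a primary increase its expected payoff, given that state, by a unilateral change of strategy; it is symmetric if all primaries use the same strategy. **Theorem.** There exists a unique symmetric NE. Uniqueness is that of the strategies, not only of the probabilities with which nodes are selected: any two symmetric NEs have, for every channel state $j$, the same probability mass function over independent sets and, at each node that is selected with positive probability in state $j$, the same penalty distribution (a distribution at a node where the channel is never offered in state $j$ is immaterial). In this NE each primary selects with positive probability only the independent sets $I_1$ and $I_2$, where $I_1$ consists of the odd-numbered nodes and $I_2$ of the even-numbered nodes. -/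

import Mathlib

open MeasureTheory

noncomputable section

/-- The data of the spectrum market.  The available channel states `1, …, n` are indexed by `Fin n`
in increasing order of transmission rate (the index `j` stands for state `j + 1`); the channel state
is the same at all locations. -/
structure Market (n : ℕ) where
  /-- number of primaries -/
  l : ℕ
  /-- number of secondaries at each location -/
  m : ℕ
  /-- `q j` is the probability that the channel of a primary is in state `j`; with the remaining
  probability it is unavailable (state `0`) -/
  q : Fin n → ℝ
  /-- the largest penalty that a secondary accepts -/
  v : ℝ
  /-- the transition cost, incurred at each location where the channel is sold -/
  c : ℝ
  /-- the prices that may be asked -/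
  prices : Set ℝ
  /-- `g j p` is the penalty of a channel in state `j` that is offered at price `p` -/
  g : Fin n → ℝ → ℝ

namespace Market

variable {n : ℕ} (K : Market n)

/-- The penalties that a channel in state `j` can have. -/
def penalties (j : Fin n) : Set ℝ := K.g j '' K.prices

/-- The inverse of `g j`: the price of a channel in state `j` whose penalty is `x`
(meaningful for `x ∈ K.penalties j`). -/
def f (j : Fin n) : ℝ → ℝ := Function.invFunOn (K.g j) K.prices

/-- The standing assumptions of the model. -/
structure Admissible : Prop where
  one_le_m : 1 ≤ K.m
  m_lt_l : K.m < K.l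
  q_pos : ∀ j, 0 < K.q j
  sum_q_lt_one : ∑ j, K.q j < 1
  /-- the admissible prices form an interval -/
  prices_interval : K.prices.OrdConnected
  cost_mem : K.c ∈ K.prices
  strictMono : ∀ j, StrictMonoOn (K.g j) K.prices
  /-- continuity is needed only if there are several available states -/
  continuous : 1 < n → ∀ j, ContinuousOn (K.g j) K.prices
  /-- a better channel has a lower penalty at the same price -/
  penalty_lt : ∀ i j, i < j → ∀ p ∈ K.prices, K.g j p < K.g i p
  /-- the penalty `v` can be attained in each state -/
  v_mem : ∀ j, K.v ∈ K.penalties j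
  /-- a sale at penalty `v` is profitable -/
  cost_lt : ∀ j, K.g j K.c < K.v
  /-- `(f i y - c) / (f j y - c)` is strictly increasing in `y > g i c` for `i < j` -/
  ratio_lt : ∀ i j, i < j → ∀ x ∈ K.penalties i ∩ K.penalties j,
    ∀ y ∈ K.penalties i ∩ K.penalties j, K.g i K.c < y → y < x →
      (K.f i y - K.c) / (K.f j y - K.c) < (K.f i x - K.c) / (K.f j x - K.c)

variable {V : Type*} [Fintype V] [DecidableEq V] (G : SimpleGraph V)

/-- What a primary does when its channel is in state `j`: it selects an independent set of the
conflict graph at random, and offers the channel at each node `a` of that set at a penalty drawn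
from the distribution that it uses at `a`. -/
structure StateStrategy (j : Fin n) where
  /-- the probability mass function over the independent sets -/
  select : Finset V → ℝ
  select_nonneg : ∀ I, 0 ≤ select I
  select_sum : ∑ I, select I = 1
  select_indep : ∀ I, select I ≠ 0 → G.IsIndepSet (I : Set V)
  /-- the penalty distribution at each node -/
  penalty : V → ProbabilityMeasure ℝ
  penalty_mem : ∀ a, ∀ᵐ x ∂(penalty a : Measure ℝ), x ∈ K.penalties j
  /-- expected payoffs are finite (automatic if the prices are bounded below) -/
  integrable : ∀ a, IntegrableOn (K.f j) (Set.Iic K.v) (penalty a : Measure ℝ)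

/-- A strategy of a primary. -/
abbrev Strategy := ∀ j : Fin n, K.StateStrategy G j

/-- A strategy profile: a strategy for each primary. -/
abbrev Profile := Fin K.l → K.Strategy G

variable {K G}

/-- The probability that node `a` is in the selected independent set. -/
def StateStrategy.nodeProb {j : Fin n} (ψ : K.StateStrategy G j) (a : V) : ℝ :=
  ∑ I with a ∈ I, ψ.select I

/-- The probability that a primary with strategy `T` offers its channel at node `a` at a penalty
in `B` (its channel state being random). -/
def offerProb (T : K.Strategy G) (a : V) (B : Set ℝ) : ℝ :=
  ∑ j, K.q j * (T j).nodeProb a * ((T j).penalty a : Measure ℝ).real B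

/-- The probabilities of the three ways in which a competitor with strategy `T` can compare, at
node `a`, with an offer at penalty `x`: it offers at a penalty below `x` (`lt`); it offers at
penalty `x` (`eq`); it offers at a penalty above `x` or makes no offer at `a` (`gt`). -/
def rankProb (T : K.Strategy G) (a : V) (x : ℝ) : Ordering → ℝ
  | .lt => offerProb T a (Set.Iio x)
  | .eq => offerProb T a {x}
  | .gt => 1 - offerProb T a (Set.Iic x)

end Market

/-- The probability that an offer is sold to one of `m` secondaries when `b` competing offers have a
lower penalty and `t` competing offers the same penalty, ties being broken uniformly at random: the
`m - b` remaining secondaries (none if `m ≤ b`) buy from `t + 1` tied primaries. -/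
def saleShare (m b t : ℕ) : ℝ := min 1 (((m - b : ℕ) : ℝ) / ((t : ℝ) + 1))

namespace Market

variable {n : ℕ} {K : Market n} {V : Type*} [Fintype V] [DecidableEq V] {G : SimpleGraph V}

/-- The probability that primary `i` sells its channel at node `a` when it offers it there at
penalty `x ≤ v`: the other primaries act independently of each other; `σ k` tells how primary `k`
compares with `i`. -/
def winProb (S : K.Profile G) (i : Fin K.l) (a : V) (x : ℝ) : ℝ :=
  ∑ σ : ({k : Fin K.l // k ≠ i} → Ordering),
    (∏ k : {k : Fin K.l // k ≠ i}, rankProb (S k.1) a x (σ k)) *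
      saleShare K.m (Fintype.card {k // σ k = .lt}) (Fintype.card {k // σ k = .eq})

/-- The expected payoff of primary `i` at node `a` when its channel is in state `j` and is offered
there at penalty `x`; nobody buys at a penalty above `v`. -/
def nodePayoff (S : K.Profile G) (i : Fin K.l) (j : Fin n) (a : V) (x : ℝ) : ℝ :=
  if x ≤ K.v then (K.f j x - K.c) * winProb S i a x else 0

/-- The expected payoff of primary `i` when its channel is in state `j`, it uses `ψ`, and the other
primaries use their strategies in `S` (the entry `S i` is not used). -/
def payoff (S : K.Profile G) (i : Fin K.l) (j : Fin n) (ψ : K.StateStrategy G j) : ℝ :=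
  ∑ I, ψ.select I * ∑ a ∈ I, ∫ x, nodePayoff S i j a x ∂(ψ.penalty a : Measure ℝ)

/-- Nash equilibrium: in no channel state can a primary gain by deviating unilaterally. -/
def IsNE (S : K.Profile G) : Prop :=
  ∀ i j, ∀ ψ : K.StateStrategy G j, payoff S i j ψ ≤ payoff S i j (S i j)

/-- Symmetric Nash equilibrium: all primaries use the same strategy. -/
def IsSymmetricNE (S : K.Profile G) : Prop :=
  IsNE S ∧ ∀ i k, S i = S k

/-- Two strategies coincide: in each channel state they select each independent set with the same
probability, and they use the same penalty distribution at each node that is selected with positive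
probability (a penalty distribution at a node where the channel is never offered is immaterial). -/
def Strategy.Same (T T' : K.Strategy G) : Prop :=
  ∀ j, (T j).select = (T' j).select ∧
    ∀ a, 0 < (T j).nodeProb a → (T j).penalty a = (T' j).penalty a

end Market

/-- The nodes of the path on `M` nodes with an odd number; nodes are numbered `1, …, M`, and
`a : Fin M` is the node with number `a + 1`. -/
def oddNodes (M : ℕ) : Finset (Fin M) := {a | Odd ((a : ℕ) + 1)}

/-- The nodes of the path on `M` nodes with an even number. -/
def evenNodes (M : ℕ) : Finset (Fin M) := {a | Even ((a : ℕ) + 1)}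

end

/-! In a symmetric profile the payoff of a primary is a sum over nodes. An equilibrium therefore
amounts to two conditions: at each node the penalties in use are best responses (`NodeEq`), and
every selected independent set maximises the sum of the node values (`IsSymmetricNE.exists_nodeEq`,
`isSymmetricNE_const`). Ties are excluded because undercutting them slightly pays
(`load_singleton_eq_zero`). Hence an offer at `x` sells with probability `W` of the load on `Iic x`,
where `W` is continuous and strictly decreasing.

One node, with offer probabilities `α` fixed. The ratio assumption gives single crossing: if a worse
state weakly prefers the lower of two penalties, every better state strictly prefers it. So the
states occupy successive blocks of penalties, the best state lowest, and the block ends are found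
downwards from `v` by indifference. This determines the penalty laws (`NodeEq.penalty_eq`,
`exists_nodeEq`). The node values become a function `value` of the tails of `α`, the offer
probabilities of the states from a given one upwards. Smaller tails up to a state mean a larger
value of that state (`IsLoad.value_le`).

The path. If some edge were missed with positive probability, take the leftmost edge `{k, k + 1}`
whose total missing probability is maximal, and the worst state in which it is missed. Optimality of
a set that misses it forces `U k ≤ U (k - 1)` and `U (k + 1) ≤ U (k + 2)` in that state. Comparing
the missing probabilities with those of the two adjacent edges compares tails, and `value_le` turns
this into `U (k - 1) < U (k + 1)` and `U (k + 2) ≤ U k`, a contradiction. So selected sets meet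
every edge and consist of the nodes of one parity.

What remains is the probability `t j` of selecting the odd nodes in state `j`. The advantage of the
odd class in state `j` depends only on the tails with index at most `j`, and it decreases in them.
This triangular monotone system has a solution, built state by state as continuous monotone families
(`exists_balanced_family`), and only one (`balanced_unique`). The solution is an equilibrium because
no independent set beats both classes when node values depend only on parity (`sum_le_max`). -/

noncomputable section

/-! ### Sale probabilities and ties -/

/-- The expected share of a sale against independent competitors indexed by `ι`, each of which has
a lower, an equal or a higher penalty with the probabilities given by `p`. -/
def tieWin (ι : Type*) [Fintype ι] [DecidableEq ι] (m : ℕ) (p : Ordering → ℝ) : ℝ :=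
  ∑ σ : ι → Ordering, (∏ k, p (σ k)) *
    saleShare m (Fintype.card {k // σ k = .lt}) (Fintype.card {k // σ k = .eq})

/-- The distribution on the three comparisons with weights `p`, `e` and `1 - p - e`. -/
def rankWeights (p e : ℝ) : Ordering → ℝ
  | .lt => p
  | .eq => e
  | .gt => 1 - (p + e)

section TieWin

variable {ι κ : Type*} [Fintype ι] [DecidableEq ι] [Fintype κ] [DecidableEq κ]

lemma tieWin_congr_equiv (e : ι ≃ κ) (m : ℕ) (p : Ordering → ℝ) :
    tieWin ι m p = tieWin κ m p := by
  unfold tieWin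
  rw [← Equiv.sum_comp (e.arrowCongr (Equiv.refl Ordering))]
  refine Finset.sum_congr rfl fun σ _ => ?_
  have h (o : Ordering) : Fintype.card {k : κ // (e.arrowCongr (Equiv.refl Ordering)) σ k = o}
      = Fintype.card {k : ι // σ k = o} :=
    Fintype.card_congr (e.symm.subtypeEquiv fun k => by simp [Equiv.arrowCongr])
  rw [h, h]
  congr 1
  rw [← Equiv.prod_comp e.symm]
  rfl

/-- Independent comparisons stay independent when each is relabelled by `π`. This puts the laws
before and after relabelling on one sample space, where sale shares can be compared outcome by
outcome. -/
lemma sum_prod_map (π : Ordering → Ordering) (p : Ordering → ℝ) (G : (ι → Ordering) → ℝ) :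
    ∑ τ : ι → Ordering, (∏ k, ∑ o with π o = τ k, p o) * G τ
      = ∑ σ : ι → Ordering, (∏ k, p (σ k)) * G (fun k => π (σ k)) := by
  rw [← Finset.sum_fiberwise (s := Finset.univ)
    (g := fun σ : ι → Ordering => fun k => π (σ k))
    (f := fun σ => (∏ k, p (σ k)) * G (fun k => π (σ k)))]
  refine Finset.sum_congr rfl fun τ _ => ?_
  rw [Finset.prod_univ_sum, Finset.sum_mul]
  refine Finset.sum_congr ?_ ?_
  · ext σ
    simp [Fintype.mem_piFinset, funext_iff]
  · intro σ hσ
    have : (fun k => π (σ k)) = τ := by simpa using hσ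
    rw [this]

/-- An equal penalty counted as a lower one. -/
def eqToLt : Ordering → Ordering
  | .eq => .lt
  | o => o

/-- An equal penalty counted as a higher one. -/
def eqToGt : Ordering → Ordering
  | .eq => .gt
  | o => o

lemma univ_ordering : (Finset.univ : Finset Ordering) = {.lt, .eq, .gt} := rfl

lemma tieWin_eqToLt (m : ℕ) (p e : ℝ) :
    tieWin ι m (rankWeights (p + e) 0) = ∑ σ : ι → Ordering, (∏ k, rankWeights p e (σ k)) *
      saleShare m (Fintype.card {k // eqToLt (σ k) = .lt})
        (Fintype.card {k // eqToLt (σ k) = .eq}) := by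
  rw [← sum_prod_map eqToLt (rankWeights p e) fun τ : ι → Ordering =>
    saleShare m (Fintype.card {k // τ k = .lt}) (Fintype.card {k // τ k = .eq})]
  refine Finset.sum_congr rfl fun τ _ => ?_
  congr 1
  refine Finset.prod_congr rfl fun k _ => ?_
  rw [Finset.sum_filter, univ_ordering]
  cases τ k <;> simp [eqToLt, rankWeights]

lemma tieWin_eqToGt (m : ℕ) (p e : ℝ) :
    tieWin ι m (rankWeights p 0) = ∑ σ : ι → Ordering, (∏ k, rankWeights p e (σ k)) *
      saleShare m (Fintype.card {k // eqToGt (σ k) = .lt})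
        (Fintype.card {k // eqToGt (σ k) = .eq}) := by
  rw [← sum_prod_map eqToGt (rankWeights p e) fun τ : ι → Ordering =>
    saleShare m (Fintype.card {k // τ k = .lt}) (Fintype.card {k // τ k = .eq})]
  refine Finset.sum_congr rfl fun τ _ => ?_
  congr 1
  refine Finset.prod_congr rfl fun k _ => ?_
  rw [Finset.sum_filter, univ_ordering]
  cases τ k <;> simp [eqToGt, rankWeights]; ring

lemma saleShare_nonneg (m b t : ℕ) : 0 ≤ saleShare m b t := by
  unfold saleShare; positivity

lemma saleShare_zero_of_lt {m b : ℕ} (h : b < m) : saleShare m b 0 = 1 := by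
  unfold saleShare
  have : (1 : ℝ) ≤ ((m - b : ℕ) : ℝ) := by exact_mod_cast (by omega : 1 ≤ m - b)
  simpa using this

lemma saleShare_of_le {m b : ℕ} (t : ℕ) (h : m ≤ b) : saleShare m b t = 0 := by
  unfold saleShare
  simp [Nat.sub_eq_zero_of_le h]

lemma saleShare_le_one (m b t : ℕ) : saleShare m b t ≤ 1 := min_le_left _ _

lemma saleShare_le_zero_ties (m b t : ℕ) : saleShare m b t ≤ saleShare m b 0 := by
  rcases lt_or_ge b m with h | h
  · rw [saleShare_zero_of_lt h]; exact saleShare_le_one _ _ _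
  · rw [saleShare_of_le _ h, saleShare_of_le _ h]

lemma saleShare_add_le (m b t : ℕ) : saleShare m (b + t) 0 ≤ saleShare m b t := by
  rcases lt_or_ge (b + t) m with h | h
  · rw [saleShare_zero_of_lt h]
    unfold saleShare
    refine le_min le_rfl ?_
    rw [le_div_iff₀ (by positivity), one_mul]
    exact_mod_cast (by omega : t + 1 ≤ m - b)
  · rw [saleShare_of_le _ h]; exact saleShare_nonneg _ _ _

lemma card_eqToLt_lt (σ : ι → Ordering) : Fintype.card {k // eqToLt (σ k) = .lt}
    = Fintype.card {k // σ k = .lt} + Fintype.card {k // σ k = .eq} := by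
  simp only [Fintype.card_subtype]
  rw [← Finset.card_union_of_disjoint]
  · congr 1
    ext k
    simp only [Finset.mem_filter_univ, Finset.mem_union]
    cases σ k <;> simp [eqToLt]
  · rw [Finset.disjoint_filter]
    intro k _ h; simp [h]

lemma card_eqToLt_eq (σ : ι → Ordering) : Fintype.card {k // eqToLt (σ k) = .eq} = 0 := by
  rw [Fintype.card_eq_zero_iff]
  exact ⟨fun ⟨k, hk⟩ => by cases h : σ k <;> simp [eqToLt, h] at hk⟩

lemma card_eqToGt_lt (σ : ι → Ordering) : Fintype.card {k // eqToGt (σ k) = .lt}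
    = Fintype.card {k // σ k = .lt} := by
  simp only [Fintype.card_subtype]
  congr 1
  ext k
  simp only [Finset.mem_filter_univ]
  cases σ k <;> simp [eqToGt]

lemma card_eqToGt_eq (σ : ι → Ordering) : Fintype.card {k // eqToGt (σ k) = .eq} = 0 := by
  rw [Fintype.card_eq_zero_iff]
  exact ⟨fun ⟨k, hk⟩ => by cases h : σ k <;> simp [eqToGt, h] at hk⟩

lemma rankWeights_nonneg {p e : ℝ} (hp : 0 ≤ p) (he : 0 ≤ e) (h : p + e ≤ 1) (o : Ordering) :
    0 ≤ rankWeights p e o := by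
  cases o <;> simp only [rankWeights] <;> linarith

/-- Demoting a tied offer below all its competitors can only cost sales, in every outcome. -/
lemma tieWin_add_le (m : ℕ) {p e : ℝ} (hp : 0 ≤ p) (he : 0 ≤ e) (h : p + e ≤ 1) :
    tieWin ι m (rankWeights (p + e) 0) ≤ tieWin ι m (rankWeights p e) := by
  rw [tieWin_eqToLt]
  refine Finset.sum_le_sum fun σ _ => mul_le_mul_of_nonneg_left ?_
    (Finset.prod_nonneg fun k _ => rankWeights_nonneg hp he h _)
  rw [card_eqToLt_lt, card_eqToLt_eq]
  exact saleShare_add_le _ _ _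

/-- Winning every tie never hurts, and it gains strictly when all competitors tie: that outcome has
positive probability and then `m` buyers face more than `m` offers. -/
lemma tieWin_lt (m : ℕ) {p e : ℝ} (hp : 0 ≤ p) (he : 0 < e) (h : p + e ≤ 1) (hm : 1 ≤ m)
    (hι : m ≤ Fintype.card ι) :
    tieWin ι m (rankWeights p e) < tieWin ι m (rankWeights p 0) := by
  rw [tieWin_eqToGt m p e]
  have hw (σ : ι → Ordering) : 0 ≤ ∏ k, rankWeights p e (σ k) :=
    Finset.prod_nonneg fun k _ => rankWeights_nonneg hp he.le h _
  refine Finset.sum_lt_sum (fun σ _ => mul_le_mul_of_nonneg_left ?_ (hw σ))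
    ⟨fun _ => .eq, Finset.mem_univ _, mul_lt_mul_of_pos_left ?_ ?_⟩
  · rw [card_eqToGt_lt, card_eqToGt_eq]
    exact saleShare_le_zero_ties _ _ _
  · rw [card_eqToGt_lt, card_eqToGt_eq]
    have h1 : Fintype.card {k : ι // Ordering.eq = .lt} = 0 := by simp
    have h2 : Fintype.card {k : ι // Ordering.eq = Ordering.eq} = Fintype.card ι := by simp
    rw [h1, h2, saleShare_zero_of_lt (by omega)]
    unfold saleShare
    refine min_lt_of_right_lt ?_
    rw [div_lt_one (by positivity)]
    exact_mod_cast (by omega : m - 0 < Fintype.card ι + 1)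
  · exact Finset.prod_pos fun k _ => he

lemma tieWin_le (m : ℕ) {p e : ℝ} (hp : 0 ≤ p) (he : 0 ≤ e) (h : p + e ≤ 1) :
    tieWin ι m (rankWeights p e) ≤ tieWin ι m (rankWeights p 0) := by
  rw [tieWin_eqToGt m p e]
  refine Finset.sum_le_sum fun σ _ => mul_le_mul_of_nonneg_left ?_
    (Finset.prod_nonneg fun k _ => rankWeights_nonneg hp he h _)
  rw [card_eqToGt_lt, card_eqToGt_eq]
  exact saleShare_le_zero_ties _ _ _

end TieWin

namespace Market

variable {n : ℕ} (K : Market n)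

/-- The probability that an offer is sold when each of the `l - 1` competitors independently makes
a better offer with probability `s`, and there are no ties. -/
def W (s : ℝ) : ℝ := tieWin (Fin (K.l - 1)) K.m (rankWeights s 0)

lemma continuous_W : Continuous K.W := by
  unfold W tieWin
  refine continuous_finsetSum _ fun σ _ => Continuous.mul (continuous_finsetProd _ fun k _ => ?_)
    continuous_const
  cases σ k <;> simp only [rankWeights] <;> fun_prop

variable {K}

/-- The extra mass `t - s` of better offers is first turned into ties and then into worse offers;
the second change gains strictly. -/
lemma Admissible.W_strictAntiOn (hK : K.Admissible) : StrictAntiOn K.W (Set.Icc 0 1) := by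
  intro s hs t ht hst
  have hm := hK.one_le_m
  have hl := hK.m_lt_l
  have h1 := tieWin_add_le (ι := Fin (K.l - 1)) K.m (p := s) (e := t - s) hs.1 (by linarith)
    (by linarith [ht.2])
  have h2 := tieWin_lt (ι := Fin (K.l - 1)) K.m (p := s) (e := t - s) hs.1 (by linarith)
    (by linarith [ht.2]) hm (by simp; omega)
  rw [add_sub_cancel] at h1
  exact h1.trans_lt h2

lemma Admissible.W_zero (hK : K.Admissible) : K.W 0 = 1 := by
  unfold W tieWin
  rw [Finset.sum_eq_single fun _ => Ordering.gt]
  · have h1 : Fintype.card {k : Fin (K.l - 1) // Ordering.gt = .lt} = 0 := by simp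
    have h2 : Fintype.card {k : Fin (K.l - 1) // Ordering.gt = .eq} = 0 := by simp
    rw [h1, h2, saleShare_zero_of_lt hK.one_le_m]
    simp [rankWeights]
  · intro σ _ hσ
    obtain ⟨k, hk⟩ := Function.ne_iff.1 hσ
    rw [Finset.prod_eq_zero (Finset.mem_univ k), zero_mul]
    cases h : σ k <;> simp_all [rankWeights]
  · simp

lemma Admissible.W_pos (hK : K.Admissible) {s : ℝ} (h0 : 0 ≤ s) (h1 : s < 1) : 0 < K.W s := by
  have h0' : 0 ≤ K.W 1 := by
    refine Finset.sum_nonneg fun σ _ => mul_nonneg (Finset.prod_nonneg fun k _ =>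
      rankWeights_nonneg zero_le_one le_rfl (by norm_num) _) (saleShare_nonneg _ _ _)
  exact h0'.trans_lt (hK.W_strictAntiOn ⟨h0, h1.le⟩ ⟨zero_le_one, le_rfl⟩ h1)

lemma Admissible.W_le_one (hK : K.Admissible) {s : ℝ} (h0 : 0 ≤ s) (h1 : s ≤ 1) : K.W s ≤ 1 := by
  rw [← hK.W_zero]
  exact hK.W_strictAntiOn.antitoneOn ⟨le_rfl, zero_le_one⟩ ⟨h0, h1⟩ h0

lemma Admissible.W_le_W_iff (hK : K.Admissible) {s t : ℝ} (hs : s ∈ Set.Icc (0 : ℝ) 1)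
    (ht : t ∈ Set.Icc (0 : ℝ) 1) : K.W s ≤ K.W t ↔ t ≤ s :=
  hK.W_strictAntiOn.le_iff_ge hs ht

end Market

end

/-! ### Single crossing and uniqueness of the equilibrium at a node -/

noncomputable section

/-- The set is a down-set. If it has a greatest element the bound is immediate; otherwise it is
covered by a directed countable union of rational half-lines, each of measure at most `r`. -/
lemma measureReal_setOf_cdf_le (ν : Measure ℝ) [IsFiniteMeasure ν] {r : ℝ} (hr : 0 ≤ r) :
    ν.real {w | ν.real (Set.Iic w) ≤ r} ≤ r := by
  set B : Set ℝ := {w | ν.real (Set.Iic w) ≤ r} with hB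
  have hlower {u w : ℝ} (h : u ≤ w) (hw : w ∈ B) : u ∈ B :=
    (measureReal_mono (Set.Iic_subset_Iic.2 h)).trans hw
  by_cases hmax : ∃ w ∈ B, ∀ u ∈ B, u ≤ w
  · obtain ⟨w, hw, h⟩ := hmax
    exact (measureReal_mono fun u hu => h u hu).trans hw
  · push Not at hmax
    have hsub : B ⊆ ⋃ p : {p : ℚ // (p : ℝ) ∈ B}, Set.Iic ((p : ℚ) : ℝ) := by
      intro w hw
      obtain ⟨u, hu, hwu⟩ := hmax w hw
      obtain ⟨p, hp, hpu⟩ := exists_rat_btwn hwu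
      exact Set.mem_iUnion.2 ⟨⟨p, hlower hpu.le hu⟩, hp.le⟩
    have hle : ν B ≤ ENNReal.ofReal r := by
      refine (measure_mono hsub).trans ?_
      rw [Directed.measure_iUnion]
      · refine iSup_le fun p => ?_
        rw [← ofReal_measureReal]
        exact ENNReal.ofReal_le_ofReal p.2
      · intro p p'
        rcases le_total (p : ℚ) p' with h | h
        · exact ⟨p', Set.Iic_subset_Iic.2 (by exact_mod_cast h), le_rfl⟩
        · exact ⟨p, le_rfl, Set.Iic_subset_Iic.2 (by exact_mod_cast h)⟩
    exact ENNReal.toReal_le_of_le_ofReal hr hle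

namespace Market

variable {n : ℕ} {K : Market n}

section Prices

lemma f_mem_prices {j : Fin n} {x : ℝ} (hx : x ∈ K.penalties j) : K.f j x ∈ K.prices :=
  Function.invFunOn_mem hx

lemma g_f {j : Fin n} {x : ℝ} (hx : x ∈ K.penalties j) : K.g j (K.f j x) = x :=
  Function.invFunOn_eq hx

lemma g_mem {j : Fin n} {p : ℝ} (hp : p ∈ K.prices) : K.g j p ∈ K.penalties j :=
  Set.mem_image_of_mem _ hp

lemma Admissible.f_g (hK : K.Admissible) {j : Fin n} {p : ℝ} (hp : p ∈ K.prices) :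
    K.f j (K.g j p) = p :=
  (hK.strictMono j).injOn (f_mem_prices (g_mem hp)) hp (g_f (g_mem hp))

lemma Admissible.f_strictMonoOn (hK : K.Admissible) (j : Fin n) :
    StrictMonoOn (K.f j) (K.penalties j) := by
  intro x hx y hy hxy
  rw [← g_f hx, ← g_f hy] at hxy
  exact ((hK.strictMono j).lt_iff_lt (f_mem_prices hx) (f_mem_prices hy)).1 hxy

lemma Admissible.cost_lt_f_iff (hK : K.Admissible) {j : Fin n} {x : ℝ}
    (hx : x ∈ K.penalties j) : K.c < K.f j x ↔ K.g j K.c < x := by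
  rw [← (hK.strictMono j).lt_iff_lt hK.cost_mem (f_mem_prices hx), g_f hx]

lemma Admissible.cost_lt_f_v (hK : K.Admissible) (j : Fin n) : K.c < K.f j K.v :=
  (hK.cost_lt_f_iff (hK.v_mem j)).2 (hK.cost_lt j)

lemma Admissible.f_le_f_v (hK : K.Admissible) {j : Fin n} {x : ℝ}
    (hx : x ∈ K.penalties j) (hxv : x ≤ K.v) : K.f j x ≤ K.f j K.v :=
  (hK.f_strictMonoOn j).monotoneOn hx (hK.v_mem j) hxv

lemma Admissible.penalties_ordConnected (hK : K.Admissible) (hn : 1 < n) (j : Fin n) :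
    (K.penalties j).OrdConnected :=
  (hK.prices_interval.isPreconnected.image _ (hK.continuous hn j)).ordConnected

lemma Admissible.mem_penalties (hK : K.Admissible) (hn : 1 < n) {j : Fin n} {x : ℝ}
    (h1 : K.g j K.c ≤ x) (h2 : x ≤ K.v) : x ∈ K.penalties j :=
  (hK.penalties_ordConnected hn j).out (g_mem hK.cost_mem) (hK.v_mem j) ⟨h1, h2⟩

lemma one_lt_of_fin_lt {i j : Fin n} (h : i < j) : 1 < n := by
  have := j.2
  have : (i : ℕ) < j := h
  omega

/-- Above the cost of a worse state all penalties are possible in a better one. -/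
lemma Admissible.mem_penalties_of_le (hK : K.Admissible) {i j : Fin n} (hij : i ≤ j) {x : ℝ}
    (hx : x ∈ K.penalties i) (h1 : K.c < K.f i x) (h2 : x ≤ K.v) :
    x ∈ K.penalties j ∧ K.c < K.f j x := by
  rcases hij.eq_or_lt with rfl | hij
  · exact ⟨hx, h1⟩
  have h : K.g j K.c < x :=
    (hK.penalty_lt i j hij _ hK.cost_mem).trans ((hK.cost_lt_f_iff hx).1 h1)
  have hm := hK.mem_penalties (one_lt_of_fin_lt hij) h.le h2
  exact ⟨hm, (hK.cost_lt_f_iff hm).2 h⟩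

/-- Single crossing: if a worse state weakly prefers the lower penalty `x` to `y`, then a better
state strictly prefers it. -/
lemma Admissible.single_crossing (hK : K.Admissible) {i j : Fin n} (hij : i < j) {x y wx wy : ℝ}
    (hx : x ∈ K.penalties i) (hxc : K.c < K.f i x) (hxy : x < y) (hy : y ≤ K.v)
    (hwx : 0 < wx)
    (h : (K.f i y - K.c) * wy ≤ (K.f i x - K.c) * wx) :
    (K.f j y - K.c) * wy < (K.f j x - K.c) * wx := by
  have hgx := (hK.cost_lt_f_iff hx).1 hxc
  have hyi := hK.mem_penalties (one_lt_of_fin_lt hij) (hgx.trans hxy).le hy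
  have hyc := (hK.cost_lt_f_iff hyi).2 (hgx.trans hxy)
  obtain ⟨hxj, hxjc⟩ := hK.mem_penalties_of_le hij.le hx hxc (hxy.le.trans hy)
  obtain ⟨hyj, hyjc⟩ := hK.mem_penalties_of_le hij.le hyi hyc hy
  have hr := hK.ratio_lt i j hij y ⟨hyi, hyj⟩ x ⟨hx, hxj⟩ hgx hxy
  have hA := sub_pos.2 hxc
  have hB := sub_pos.2 hyc
  have hC := sub_pos.2 hxjc
  have hD := sub_pos.2 hyjc
  rw [div_lt_div_iff₀ hC hD] at hr
  have h1 := mul_le_mul_of_nonneg_right h hC.le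
  have h2 := mul_lt_mul_of_pos_right hr hwx
  have h3 : (K.f i y - K.c) * ((K.f j y - K.c) * wy)
      < (K.f i y - K.c) * ((K.f j x - K.c) * wx) := by
    have h4 := mul_le_mul_of_nonneg_right h hD.le
    nlinarith
  exact lt_of_mul_lt_mul_left h3 hB.le

end Prices

/-- The total probability of offers from the states `i, i + 1, …` when the channel is offered with
probability `α k` in state `k`. -/
def tail (K : Market n) (α : Fin n → ℝ) (i : ℕ) : ℝ :=
  ∑ k with i ≤ (k : Fin n).val, K.q k * α k

/-- The probability of an offer in `B` when the channel is offered with probability `α k` in state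
`k`, with penalty distribution `μ k`. -/
def load (K : Market n) (α : Fin n → ℝ) (μ : Fin n → ProbabilityMeasure ℝ) (B : Set ℝ) : ℝ :=
  ∑ j, K.q j * α j * (μ j : Measure ℝ).real B

/-- The penalty `x` yields the expected payoff `U` in state `j`. -/
def IsBest (K : Market n) (α : Fin n → ℝ) (μ : Fin n → ProbabilityMeasure ℝ) (j : Fin n)
    (U x : ℝ) : Prop :=
  x ∈ K.penalties j ∧ x ≤ K.v ∧ (K.f j x - K.c) * K.W (K.load α μ (Set.Iic x)) = U

/-- The conditions of an equilibrium at a single node: `U j` is the best possible expected payoff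
in state `j`, and it is attained by the penalty distribution `μ j` if `0 < α j`. -/
structure NodeEq (K : Market n) (α : Fin n → ℝ) (μ : Fin n → ProbabilityMeasure ℝ)
    (U : Fin n → ℝ) : Prop where
  nonneg : ∀ j, 0 ≤ α j
  le_one : ∀ j, α j ≤ 1
  atom : ∀ x, K.load α μ {x} = 0
  le : ∀ j, ∀ x ∈ K.penalties j, x ≤ K.v →
    (K.f j x - K.c) * K.W (K.load α μ (Set.Iic x)) ≤ U j
  approx : ∀ j, ∀ ε > 0, ∃ x ∈ K.penalties j, x ≤ K.v ∧
    U j - ε < (K.f j x - K.c) * K.W (K.load α μ (Set.Iic x))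
  best : ∀ j, 0 < α j → ∀ᵐ x ∂(μ j : Measure ℝ), K.IsBest α μ j (U j) x

section Load

variable {α : Fin n → ℝ} {μ : Fin n → ProbabilityMeasure ℝ}

lemma load_nonneg (hK : K.Admissible) (h0 : ∀ j, 0 ≤ α j) (B : Set ℝ) : 0 ≤ K.load α μ B :=
  Finset.sum_nonneg fun j _ =>
    mul_nonneg (mul_nonneg (hK.q_pos j).le (h0 j)) measureReal_nonneg

lemma load_mono (hK : K.Admissible) (h0 : ∀ j, 0 ≤ α j) {A B : Set ℝ} (h : A ⊆ B) :
    K.load α μ A ≤ K.load α μ B :=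
  Finset.sum_le_sum fun j _ =>
    mul_le_mul_of_nonneg_left (measureReal_mono h) (mul_nonneg (hK.q_pos j).le (h0 j))

lemma tail_nonneg (hK : K.Admissible) (h0 : ∀ j, 0 ≤ α j) (i : ℕ) : 0 ≤ K.tail α i :=
  Finset.sum_nonneg fun j _ => mul_nonneg (hK.q_pos j).le (h0 j)

lemma tail_succ_add (j : Fin n) : K.tail α j = K.q j * α j + K.tail α (j + 1) := by
  unfold tail
  rw [← Finset.sum_insert (s := Finset.univ.filter fun k : Fin n => (j : ℕ) + 1 ≤ k)
    (f := fun k => K.q k * α k) (by simp)]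
  refine Finset.sum_congr ?_ fun _ _ => rfl
  ext k
  simp only [Finset.mem_filter_univ, Finset.mem_insert, Fin.ext_iff]
  omega

lemma tail_of_le {i : ℕ} (h : n ≤ i) : K.tail α i = 0 := by
  unfold tail
  rw [Finset.filter_false_of_mem fun k _ => by have := k.2; omega]
  simp

lemma tail_antitone (hK : K.Admissible) (h0 : ∀ j, 0 ≤ α j) : Antitone (K.tail α) := by
  intro i i' h
  refine Finset.sum_le_sum_of_subset_of_nonneg ?_ fun k _ _ =>
    mul_nonneg (hK.q_pos k).le (h0 k)
  intro k
  simp only [Finset.mem_filter_univ]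
  omega

lemma tail_zero_lt_one (hK : K.Admissible) (h1 : ∀ j, α j ≤ 1) : K.tail α 0 < 1 := by
  refine lt_of_le_of_lt ?_ hK.sum_q_lt_one
  simp only [tail, zero_le, Finset.filter_true]
  exact Finset.sum_le_sum fun j _ => mul_le_of_le_one_right (hK.q_pos j).le (h1 j)

lemma load_le_tail (hK : K.Admissible) (h0 : ∀ j, 0 ≤ α j) (B : Set ℝ) :
    K.load α μ B ≤ K.tail α 0 := by
  simp only [tail, zero_le, Finset.filter_true]
  exact Finset.sum_le_sum fun j _ =>
    mul_le_of_le_one_right (mul_nonneg (hK.q_pos j).le (h0 j)) measureReal_le_one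

lemma load_mem_Icc (hK : K.Admissible) (h0 : ∀ j, 0 ≤ α j) (h1 : ∀ j, α j ≤ 1) (B : Set ℝ) :
    K.load α μ B ∈ Set.Icc (0 : ℝ) 1 :=
  ⟨load_nonneg hK h0 B, (load_le_tail hK h0 B).trans (tail_zero_lt_one hK h1).le⟩

lemma W_load_pos (hK : K.Admissible) (h0 : ∀ j, 0 ≤ α j) (h1 : ∀ j, α j ≤ 1) (B : Set ℝ) :
    0 < K.W (K.load α μ B) :=
  hK.W_pos (load_nonneg hK h0 B) ((load_le_tail hK h0 B).trans_lt (tail_zero_lt_one hK h1))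

/-- The load is a finite measure, so its distribution function obeys the general bound. This
replaces quantiles when the load may have flat pieces. -/
lemma load_setOf_load_le (hK : K.Admissible) (h0 : ∀ j, 0 ≤ α j) {r : ℝ} (hr : 0 ≤ r) :
    K.load α μ {w | K.load α μ (Set.Iic w) ≤ r} ≤ r := by
  set ν : Measure ℝ := ∑ j, (K.q j * α j).toNNReal • (μ j : Measure ℝ) with hν
  have hreal (B : Set ℝ) : ν.real B = K.load α μ B := by
    rw [hν, Measure.real, Measure.finsetSum_apply, ENNReal.toReal_sum]
    · refine Finset.sum_congr rfl fun j _ => ?_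
      rw [Measure.smul_apply, ENNReal.toReal_smul, NNReal.smul_def,
        Real.coe_toNNReal _ (mul_nonneg (hK.q_pos j).le (h0 j))]
      rfl
    · intro j _
      exact measure_ne_top _ _
  have := measureReal_setOf_cdf_le ν hr
  simpa only [hreal] using this

end Load

namespace NodeEq

variable {α : Fin n → ℝ} {μ μ' : Fin n → ProbabilityMeasure ℝ} {U U' : Fin n → ℝ}

lemma U_pos (hK : K.Admissible) (h : NodeEq K α μ U) (j : Fin n) : 0 < U j :=
  (mul_pos (sub_pos.2 (hK.cost_lt_f_v j)) (W_load_pos hK h.nonneg h.le_one _)).trans_le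
    (h.le j _ (hK.v_mem j) le_rfl)

lemma cost_lt_of_isBest (hK : K.Admissible) (h : NodeEq K α μ U) {j : Fin n} {x : ℝ}
    (hx : K.IsBest α μ j (U j) x) : K.c < K.f j x := by
  have := h.U_pos hK j
  rw [← hx.2.2] at this
  exact sub_pos.1 ((mul_pos_iff_of_pos_right (W_load_pos hK h.nonneg h.le_one _)).1 this)

/-- Otherwise almost all offers up to `x` would lie where the load is at most `r`, and such offers
have load at most `r`. -/
lemma exists_le_of_lt_load (hK : K.Admissible) (h : NodeEq K α μ U) {x r : ℝ} (hr : 0 ≤ r)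
    (hrx : r < K.load α μ (Set.Iic x)) :
    ∃ j, ∃ z ≤ x, K.IsBest α μ j (U j) z ∧ r < K.load α μ (Set.Iic z) := by
  by_contra hcon
  push Not at hcon
  refine absurd (load_setOf_load_le (μ := μ) hK h.nonneg hr) (not_le.2 (hrx.trans_le ?_))
  refine Finset.sum_le_sum fun j _ => ?_
  rcases (h.nonneg j).eq_or_lt with h0 | h0
  · simp [← h0]
  refine mul_le_mul_of_nonneg_left ?_ (mul_nonneg (hK.q_pos j).le h0.le)
  refine ENNReal.toReal_mono (measure_ne_top _ _) (measure_mono_ae ?_)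
  filter_upwards [h.best j h0] with z hz hzx
  exact hcon j z hzx hz

/-- Otherwise all the mass of the states from `i` on would lie where the load is at most `r`. -/
lemma exists_of_lt_tail (hK : K.Admissible) (h : NodeEq K α μ U) {i : ℕ} {r : ℝ} (hr : 0 ≤ r)
    (hri : r < K.tail α i) :
    ∃ j : Fin n, i ≤ j ∧ ∃ z, K.IsBest α μ j (U j) z ∧ r < K.load α μ (Set.Iic z) := by
  by_contra hcon
  push Not at hcon
  refine absurd (load_setOf_load_le (μ := μ) hK h.nonneg hr) (not_le.2 (hri.trans_le ?_))
  rw [tail, Finset.sum_filter]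
  refine Finset.sum_le_sum fun j _ => ?_
  have hq := mul_nonneg (hK.q_pos j).le (h.nonneg j)
  split_ifs with hij
  swap
  · exact mul_nonneg hq measureReal_nonneg
  rcases (h.nonneg j).eq_or_lt with h0 | h0
  · simp [← h0]
  have : (μ j : Measure ℝ) {w | K.load α μ (Set.Iic w) ≤ r} = 1 := by
    rw [measure_congr (Filter.eventuallyEq_univ.2 _), measure_univ]
    filter_upwards [h.best j h0] with z hz
    exact hcon j hij z hz
  rw [Measure.real, this, ENNReal.toReal_one, mul_one]

/-- If the better state had a best penalty `w` above `z`, the worse state's weak preference for `z`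
would become a strict one in the better state, by single crossing. -/
lemma le_of_lt (hK : K.Admissible) (h : NodeEq K α μ U) {i j : Fin n} (hij : i < j) {z w : ℝ}
    (hz : K.IsBest α μ i (U i) z) (hw : K.IsBest α μ j (U j) w) : w ≤ z := by
  by_contra! hlt
  have hzc := h.cost_lt_of_isBest hK hz
  have hgz := (hK.cost_lt_f_iff hz.1).1 hzc
  have hzj := (hK.mem_penalties_of_le hij.le hz.1 hzc (hlt.le.trans hw.2.1)).1
  have hwi := hK.mem_penalties (one_lt_of_fin_lt hij) (hgz.trans hlt).le hw.2.1
  have := hK.single_crossing hij hz.1 hzc hlt hw.2.1 (W_load_pos hK h.nonneg h.le_one _)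
    ((h.le i w hwi hw.2.1).trans_eq hz.2.2.symm)
  exact absurd (h.le j z hzj hz.2.1) (not_le.2 (hw.2.2.symm.trans_lt this))

lemma measure_singleton (hK : K.Admissible) (h : NodeEq K α μ U) {j : Fin n} (hj : 0 < α j)
    (x : ℝ) : (μ j : Measure ℝ) {x} = 0 := by
  have h1 := h.atom x
  rw [load, Finset.sum_eq_zero_iff_of_nonneg fun j _ =>
    mul_nonneg (mul_nonneg (hK.q_pos j).le (h.nonneg j)) measureReal_nonneg] at h1
  have h2 := h1 j (Finset.mem_univ _)
  rw [mul_eq_zero, or_iff_right (mul_pos (hK.q_pos j) hj).ne'] at h2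
  exact (measureReal_eq_zero_iff).1 h2

lemma measure_Iic_eq_zero (hK : K.Admissible) (h : NodeEq K α μ U) {i j : Fin n} (hij : i < j)
    (hi : 0 < α i) {z : ℝ} (hz : K.IsBest α μ j (U j) z) : (μ i : Measure ℝ) (Set.Iic z) = 0 := by
  have h1 : ∀ᵐ w ∂(μ i : Measure ℝ), w ≠ z := by
    simpa [ae_iff] using h.measure_singleton hK hi z
  rw [measure_eq_zero_iff_ae_notMem]
  filter_upwards [h1, h.best i hi] with w hwz hw hwz'
  exact hwz (le_antisymm hwz' (h.le_of_lt hK hij hw hz))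

/-- States worse than `i` put no mass at or below a best penalty of a state `j ≥ i`, so only the
states from `i` on contribute. -/
lemma load_le_tail_of_isBest (hK : K.Admissible) (h : NodeEq K α μ U) {j : Fin n} {i : ℕ}
    (hij : i ≤ j) {z : ℝ} (hz : K.IsBest α μ j (U j) z) :
    K.load α μ (Set.Iic z) ≤ K.tail α i := by
  rw [tail, Finset.sum_filter]
  refine Finset.sum_le_sum fun k _ => ?_
  split_ifs with hik
  · exact mul_le_of_le_one_right (mul_nonneg (hK.q_pos k).le (h.nonneg k)) measureReal_le_one
  rcases (h.nonneg k).eq_or_lt with h0 | h0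
  · simp [← h0]
  have hkj : k < j := Fin.lt_def.2 (by omega)
  rw [Measure.real, h.measure_Iic_eq_zero hK hkj h0 hz]; simp

/-- In state `j` there are almost optimal penalties with almost no offers above them from the
states `j, j + 1, …`. -/
lemma exists_approx_tail (hK : K.Admissible) (h : NodeEq K α μ U) (j : Fin n) {ε : ℝ}
    (hε : 0 < ε) : ∃ x ∈ K.penalties j, x ≤ K.v ∧ K.c < K.f j x ∧
      U j - ε < (K.f j x - K.c) * K.W (K.load α μ (Set.Iic x)) ∧
      K.tail α j - ε < K.load α μ (Set.Iic x) := by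
  -- Capping the error by `U j` keeps the payoff at `x` positive, so its price exceeds the cost.
  obtain ⟨x, hx, hxv, hxU⟩ := h.approx j (min ε (U j)) (lt_min hε (h.U_pos hK j))
  have hpos : 0 < (K.f j x - K.c) * K.W (K.load α μ (Set.Iic x)) :=
    lt_of_le_of_lt (sub_nonneg.2 (min_le_right _ _)) hxU
  have hxc : K.c < K.f j x :=
    sub_pos.1 ((mul_pos_iff_of_pos_right (W_load_pos hK h.nonneg h.le_one _)).1 hpos)
  have hxε : U j - ε < (K.f j x - K.c) * K.W (K.load α μ (Set.Iic x)) :=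
    lt_of_le_of_lt (sub_le_sub_left (min_le_left _ _) _) hxU
  by_cases hlt : K.tail α j - ε < K.load α μ (Set.Iic x)
  · exact ⟨x, hx, hxv, hxc, hxε, hlt⟩
  push Not at hlt
  -- If too much load lies above `x`, a state `k ≥ j` has a best penalty `z > x` with enough load
  -- below it. State `j` does at least as well at `z`: otherwise it would strictly prefer `x`, and
  -- then so would `k`.
  obtain ⟨k, hjk, z, hz, hzr⟩ := h.exists_of_lt_tail hK (i := j)
    (r := K.tail α j - ε) ((load_nonneg hK h.nonneg _).trans hlt) (by linarith)
  have hxz : x < z := by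
    by_contra! hzx
    exact absurd (load_mono (μ := μ) hK h.nonneg (Set.Iic_subset_Iic.2 hzx)) (not_le.2 (hlt.trans_lt hzr))
  have hgx := (hK.cost_lt_f_iff hx).1 hxc
  rcases (Fin.le_def.2 hjk).eq_or_lt with rfl | hjk
  · exact ⟨z, hz.1, hz.2.1, h.cost_lt_of_isBest hK hz, by rw [hz.2.2]; linarith, hzr⟩
  have hzj := hK.mem_penalties (one_lt_of_fin_lt hjk) (hgx.trans hxz).le hz.2.1
  refine ⟨z, hzj, hz.2.1, (hK.cost_lt_f_iff hzj).2 (hgx.trans hxz), hxε.trans_le ?_, hzr⟩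
  by_contra! hcon
  have := hK.single_crossing hjk hx hxc hxz hz.2.1 (W_load_pos hK h.nonneg h.le_one _) hcon.le
  rw [hz.2.2] at this
  exact absurd (h.le k x (hK.mem_penalties_of_le hjk.le hx hxc hxv).1 hxv) (not_le.2 this)

/-- At a best penalty of the second equilibrium, the first cannot promise more than `U j ≤ U' j`. So
its sale probability there is no larger, and its load no smaller. -/
lemma load_le_load_of_isBest (hK : K.Admissible) (h : NodeEq K α μ U) (h' : NodeEq K α μ' U')
    {j : Fin n} {z : ℝ} (hU : U j ≤ U' j) (hz : K.IsBest α μ' j (U' j) z) :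
    K.load α μ' (Set.Iic z) ≤ K.load α μ (Set.Iic z) := by
  rw [← hK.W_le_W_iff (load_mem_Icc hK h.nonneg h.le_one _) (load_mem_Icc hK h.nonneg h.le_one _)]
  refine le_of_mul_le_mul_left ?_ (sub_pos.2 (h'.cost_lt_of_isBest hK hz))
  rw [hz.2.2]
  exact (h.le j z hz.1 hz.2.1).trans hU

/-- An almost optimal `x` of the first equilibrium is tested in the second. The load there exceeds
the first load by at most a small error, so by continuity of `W` the payoff at `x` is nearly as
good. -/
lemma U_le (hK : K.Admissible) (h : NodeEq K α μ U) (h' : NodeEq K α μ' U') (j : Fin n)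
    (ih : ∀ i < j, U i ≤ U' i) : U j ≤ U' j := by
  have hcont : UniformContinuousOn K.W (Set.Icc 0 2) :=
    isCompact_Icc.uniformContinuousOn_of_continuous K.continuous_W.continuousOn
  set A := K.f j K.v - K.c with hA
  have hApos : 0 < A := sub_pos.2 (hK.cost_lt_f_v j)
  refine le_of_forall_pos_le_add fun ε hε => ?_
  obtain ⟨δ, hδ, hW⟩ := Metric.uniformContinuousOn_iff.1 hcont (ε / 2 / A) (by positivity)
  set η := min (min (ε / 2) (δ / 2)) 1 with hη
  have hηpos : 0 < η := by positivity
  have hη1 : η ≤ ε / 2 := (min_le_left _ _).trans (min_le_left _ _)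
  have hη2 : η ≤ δ / 2 := (min_le_left _ _).trans (min_le_right _ _)
  have hη3 : η ≤ 1 := min_le_right _ _
  obtain ⟨x, hx, hxv, hxc, hxU, hxt⟩ := h.exists_approx_tail hK j hηpos
  have hΦ := load_mem_Icc (μ := μ) hK h.nonneg h.le_one (Set.Iic x)
  have hΦ' := load_mem_Icc (μ := μ') hK h.nonneg h.le_one (Set.Iic x)
  -- An excess would show at a best penalty `z ≤ x` of some state of the second equilibrium. Worse
  -- states are excluded by the induction hypothesis, the states from `j` on because their load is
  -- capped by the tail.
  have hle : K.load α μ' (Set.Iic x) ≤ max (K.load α μ (Set.Iic x)) (K.tail α j) := by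
    by_contra! hlt
    obtain ⟨i, z, hzx, hz, hzr⟩ := h'.exists_le_of_lt_load hK
      ((load_nonneg hK h.nonneg _).trans (le_max_left _ _)) hlt
    rcases lt_or_ge i j with hij | hij
    · have h1 := h.load_le_load_of_isBest hK h' (ih i hij) hz
      have h2 := load_mono (μ := μ) hK h.nonneg (Set.Iic_subset_Iic.2 hzx)
      exact absurd (h1.trans h2) (not_le.2 ((le_max_left _ _).trans_lt hzr))
    · exact absurd (h'.load_le_tail_of_isBest hK (Fin.le_def.1 hij) hz)
        (not_le.2 ((le_max_right _ _).trans_lt hzr))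
  have hle2 : K.load α μ' (Set.Iic x) ≤ K.load α μ (Set.Iic x) + η :=
    hle.trans (max_le (by linarith) (by linarith))
  have hWle : K.W (K.load α μ (Set.Iic x)) ≤ K.W (K.load α μ' (Set.Iic x)) + ε / 2 / A := by
    rcases le_total (K.load α μ' (Set.Iic x)) (K.load α μ (Set.Iic x)) with hc | hc
    · have := (hK.W_le_W_iff hΦ hΦ').2 hc
      have : 0 < ε / 2 / A := by positivity
      linarith
    · have := hW _ ⟨hΦ.1, by linarith [hΦ.2]⟩ _ ⟨hΦ'.1, by linarith [hΦ'.2]⟩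
        (by rw [Real.dist_eq, abs_lt]; constructor <;> linarith)
      rw [Real.dist_eq, abs_lt] at this
      linarith [this.2]
  have hxA : K.f j x - K.c ≤ A := sub_le_sub_right (hK.f_le_f_v hx hxv) _
  have h1 := h'.le j x hx hxv
  have h2 := mul_le_mul_of_nonneg_left hWle (sub_pos.2 hxc).le
  have h3 : (K.f j x - K.c) * (ε / 2 / A) ≤ ε / 2 := by
    refine (mul_le_mul_of_nonneg_right hxA (by positivity)).trans_eq ?_
    field_simp
  rw [mul_add] at h2
  linarith

lemma U_eq (hK : K.Admissible) (h : NodeEq K α μ U) (h' : NodeEq K α μ' U') : U = U' := by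
  funext j
  induction j using WellFoundedLT.induction with
  | ind j ih =>
    exact le_antisymm (h.U_le hK h' j fun i hi => (ih i hi).le)
      (h'.U_le hK h j fun i hi => (ih i hi).ge)

lemma load_le_load (hK : K.Admissible) (h : NodeEq K α μ U) (h' : NodeEq K α μ' U) (x : ℝ) :
    K.load α μ' (Set.Iic x) ≤ K.load α μ (Set.Iic x) := by
  by_contra! hlt
  obtain ⟨j, z, hzx, hz, hzr⟩ :=
    h'.exists_le_of_lt_load hK (load_nonneg hK h.nonneg _) hlt
  have h1 := h.load_le_load_of_isBest hK h' le_rfl hz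
  have h2 := load_mono (μ := μ) hK h.nonneg (Set.Iic_subset_Iic.2 hzx)
  linarith

/-- The better states offer the lower penalties. -/
lemma sum_tail_eq_min (hK : K.Admissible) (h : NodeEq K α μ U) (i : ℕ) (x : ℝ) :
    ∑ k with i ≤ (k : Fin n).val, K.q k * α k * (μ k : Measure ℝ).real (Set.Iic x)
      = min (K.load α μ (Set.Iic x)) (K.tail α i) := by
  have hq (k : Fin n) : 0 ≤ K.q k * α k := mul_nonneg (hK.q_pos k).le (h.nonneg k)
  have hle1 : ∑ k with i ≤ (k : Fin n).val, K.q k * α k * (μ k : Measure ℝ).real (Set.Iic x)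
      ≤ K.load α μ (Set.Iic x) :=
    Finset.sum_le_sum_of_subset_of_nonneg (Finset.filter_subset _ _) fun k _ _ =>
      mul_nonneg (hq k) measureReal_nonneg
  have hle2 : ∑ k with i ≤ (k : Fin n).val, K.q k * α k * (μ k : Measure ℝ).real (Set.Iic x)
      ≤ K.tail α i :=
    Finset.sum_le_sum fun k _ => mul_le_of_le_one_right (hq k) measureReal_le_one
  refine le_antisymm (le_min hle1 hle2) ?_
  -- Either a worse state has a best penalty up to `x`, and then the states from `i` on offer only
  -- below it and contribute their whole tail; or no worse state offers up to `x`, and the sum is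
  -- the whole load.
  by_cases hex : ∃ k : Fin n, (k : ℕ) < i ∧ ∃ z ≤ x, K.IsBest α μ k (U k) z
  · obtain ⟨k, hki, z, hzx, hz⟩ := hex
    refine (min_le_right _ _).trans (Finset.sum_le_sum fun j hj => ?_)
    rcases (h.nonneg j).eq_or_lt with h0 | h0
    · simp [← h0]
    have hkj : k < j := Fin.lt_def.2 (hki.trans_le (Finset.mem_filter.1 hj).2)
    have : (μ j : Measure ℝ) (Set.Iic x) = 1 := by
      rw [measure_congr (Filter.eventuallyEq_univ.2 _), measure_univ]
      filter_upwards [h.best j h0] with w hw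
      exact (h.le_of_lt hK hkj hz hw).trans hzx
    rw [Measure.real, this, ENNReal.toReal_one, mul_one]
  · push Not at hex
    refine (min_le_left _ _).trans ?_
    rw [load, Finset.sum_filter]
    refine Finset.sum_le_sum fun k _ => ?_
    split_ifs with hik
    · exact le_rfl
    rcases (h.nonneg k).eq_or_lt with h0 | h0
    · simp [← h0]
    have : (μ k : Measure ℝ) (Set.Iic x) = 0 := by
      rw [measure_eq_zero_iff_ae_notMem]
      filter_upwards [h.best k h0] with w hw hwx
      exact hex k (not_le.1 hik) w hwx hw
    rw [Measure.real, this]; simp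

/-- Equal values force equal loads. The order of the blocks then gives the joint distribution
function of the states from `j` on as a minimum of load and tail; subtracting that of the states
from `j + 1` on isolates state `j`. -/
lemma penalty_eq (hK : K.Admissible) (h : NodeEq K α μ U) (h' : NodeEq K α μ' U') {j : Fin n}
    (hj : 0 < α j) : μ j = μ' j := by
  obtain rfl := h.U_eq hK h'
  suffices hm : (μ j : Measure ℝ) = μ' j from Subtype.ext hm
  refine Measure.ext_of_Iic _ _ fun x => ?_
  have hload : K.load α μ (Set.Iic x) = K.load α μ' (Set.Iic x) :=
    le_antisymm (h'.load_le_load hK h x) (h.load_le_load hK h' x)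
  have key (ν : Fin n → ProbabilityMeasure ℝ) :
      ∑ k with (j : ℕ) ≤ (k : Fin n).val, K.q k * α k * (ν k : Measure ℝ).real (Set.Iic x)
      = K.q j * α j * (ν j : Measure ℝ).real (Set.Iic x)
        + ∑ k with (j : ℕ) + 1 ≤ (k : Fin n).val,
          K.q k * α k * (ν k : Measure ℝ).real (Set.Iic x) := by
    rw [← Finset.sum_insert (s := Finset.univ.filter fun k : Fin n => (j : ℕ) + 1 ≤ k)
      (f := fun k => K.q k * α k * (ν k : Measure ℝ).real (Set.Iic x)) (by simp)]
    refine Finset.sum_congr ?_ fun _ _ => rfl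
    ext k
    simp only [Finset.mem_filter_univ, Finset.mem_insert, Fin.ext_iff]
    omega
  have h1 := key μ
  have h2 := key μ'
  rw [h.sum_tail_eq_min hK, h.sum_tail_eq_min hK] at h1
  rw [h'.sum_tail_eq_min hK, h'.sum_tail_eq_min hK] at h2
  rw [← hload] at h2
  have h3 : K.q j * α j * (μ j : Measure ℝ).real (Set.Iic x)
      = K.q j * α j * (μ' j : Measure ℝ).real (Set.Iic x) := by linarith
  have h4 := mul_left_cancel₀ (mul_pos (hK.q_pos j) hj).ne' h3
  exact (measureReal_eq_measureReal_iff).1 h4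

end NodeEq
end Market
end

/-! ### Block boundaries and values as functions of the loads -/

noncomputable section
namespace Market

variable {n : ℕ} {K : Market n}

/-- The expected payoff of an offer at penalty `x` in state `j` when a competitor makes a better
offer with probability `t`. -/
def pay (K : Market n) (j : Fin n) (x t : ℝ) : ℝ := (K.f j x - K.c) * K.W t

lemma Admissible.pay_lt_of_le (hK : K.Admissible) {i j : Fin n} (hij : i ≤ j) {x y s t : ℝ}
    (hx : x ∈ K.penalties i) (hxc : K.c < K.f i x) (hxy : x ≤ y) (hy : y ≤ K.v)
    (ht : 0 < K.W t) (h : K.pay i y s < K.pay i x t) : K.pay j y s < K.pay j x t := by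
  rcases hij.eq_or_lt with rfl | hij
  · exact h
  rcases hxy.eq_or_lt with rfl | hxy
  · have hc := (hK.mem_penalties_of_le hij.le hx hxc hy).2
    exact mul_lt_mul_of_pos_left (lt_of_mul_lt_mul_left h (sub_pos.2 hxc).le) (sub_pos.2 hc)
  · exact hK.single_crossing hij hx hxc hxy hy ht h.le

lemma Admissible.pay_le_of_le (hK : K.Admissible) {i j : Fin n} (hij : i ≤ j) {x y s t : ℝ}
    (hx : x ∈ K.penalties i) (hxc : K.c < K.f i x) (hxy : x ≤ y) (hy : y ≤ K.v)
    (ht : 0 < K.W t) (h : K.pay i y s ≤ K.pay i x t) : K.pay j y s ≤ K.pay j x t := by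
  rcases hij.eq_or_lt with rfl | hij
  · exact h
  rcases hxy.eq_or_lt with rfl | hxy
  · have hc := (hK.mem_penalties_of_le hij.le hx hxc hy).2
    exact mul_le_mul_of_nonneg_left (le_of_mul_le_mul_left h (sub_pos.2 hxc)) (sub_pos.2 hc).le
  · exact (hK.single_crossing hij hx hxc hxy hy ht h).le

/-- An increasing bijection between order-connected sets is an order isomorphism, hence a
homeomorphism. -/
lemma Admissible.continuousOn_f (hK : K.Admissible) (hn : 1 < n) (j : Fin n) :
    ContinuousOn (K.f j) (K.penalties j) := by
  have : K.prices.OrdConnected := hK.prices_interval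
  have : (K.g j '' K.prices).OrdConnected := hK.penalties_ordConnected hn j
  change ContinuousOn (K.f j) (K.g j '' K.prices)
  rw [continuousOn_iff_continuous_domRestrict]
  have h : (K.g j '' K.prices).domRestrict (K.f j)
      = Subtype.val ∘ ((hK.strictMono j).orderIso (K.g j) K.prices).symm := by
    funext x
    have h1 : ((hK.strictMono j).orderIso (K.g j) K.prices).symm x
        = ⟨K.f j x, f_mem_prices x.2⟩ := by
      rw [OrderIso.symm_apply_eq]
      exact Subtype.ext (g_f x.2).symm
    exact (congrArg Subtype.val h1).symm
  rw [h]
  exact continuous_subtype_val.comp (OrderIso.continuous _)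

/-- `s i` can be the probability of an offer from the states `i, i + 1, …`. -/
structure IsLoad (s : ℕ → ℝ) : Prop where
  nonneg : ∀ i, 0 ≤ s i
  antitone : Antitone s
  lt_one : s 0 < 1

/-- The penalties that separate the states: those of state `i` are between `boundary K s (i + 1)`
and `boundary K s i` when `s i` is the probability of an offer from the states `i, i + 1, …`. -/
def boundary (K : Market n) (s : ℕ → ℝ) : ℕ → ℝ
  | 0 => K.v
  | i + 1 => if h : i < n then
      K.g ⟨i, h⟩ (K.c + (K.f ⟨i, h⟩ (boundary K s i) - K.c) * K.W (s i) / K.W (s (i + 1)))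
    else boundary K s i

/-- The equilibrium payoff in state `j`. -/
def value (K : Market n) (s : ℕ → ℝ) (j : Fin n) : ℝ := K.pay j (K.boundary s j) (s j)

/-- The penalty below which competitors offer with probability `t`. -/
def quantile (K : Market n) (s : ℕ → ℝ) (j : Fin n) (t : ℝ) : ℝ :=
  K.g j (K.c + K.value s j / K.W t)

namespace IsLoad

variable {s s' : ℕ → ℝ}

lemma lt_one' (hs : IsLoad s) (i : ℕ) : s i < 1 := (hs.antitone (Nat.zero_le i)).trans_lt hs.lt_one

lemma mem_Icc (hs : IsLoad s) (i : ℕ) : s i ∈ Set.Icc (0 : ℝ) 1 := ⟨hs.nonneg i, (hs.lt_one' i).le⟩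

lemma W_pos (hK : K.Admissible) (hs : IsLoad s) (i : ℕ) : 0 < K.W (s i) :=
  hK.W_pos (hs.nonneg i) (hs.lt_one' i)

lemma boundary_succ (j : Fin n) : K.boundary s (j + 1) = K.quantile s j (s (j + 1)) := by
  have : (j : ℕ) < n := j.2
  simp [boundary, quantile, value, pay]

lemma left_mem (hs : IsLoad s) (j : Fin n) : s (j + 1) ∈ Set.Icc (s (j + 1)) (s j) :=
  ⟨le_rfl, hs.antitone (Nat.le_succ _)⟩

lemma right_mem (hs : IsLoad s) (j : Fin n) : s j ∈ Set.Icc (s (j + 1)) (s j) :=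
  ⟨hs.antitone (Nat.le_succ _), le_rfl⟩

variable (hK : K.Admissible) (hs : IsLoad s)
include hK hs

/-- A smaller load sells more often, so the indifference price at the lower end of a block lies
between the cost and the price at its upper end. A penalty profitable in one state is also available
and profitable in the next better state. -/
lemma boundary_mem (j : Fin n) : K.boundary s j ∈ K.penalties j ∧ K.boundary s j ≤ K.v ∧
    K.c < K.f j (K.boundary s j) := by
  obtain ⟨i, hi⟩ := j
  induction i with
  | zero => exact ⟨hK.v_mem _, le_rfl, hK.cost_lt_f_v _⟩
  | succ i ih =>
    obtain ⟨h1, h2, h3⟩ := ih (Nat.lt_of_succ_lt hi)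
    set j : Fin n := ⟨i, Nat.lt_of_succ_lt hi⟩ with hj
    have hW := hs.W_pos hK i
    have hW' := hs.W_pos hK (i + 1)
    have hle := (hK.W_le_W_iff (hs.mem_Icc i) (hs.mem_Icc (i + 1))).2 (hs.antitone (Nat.le_succ i))
    have hpos : 0 < (K.f j (K.boundary s i) - K.c) * K.W (s i) / K.W (s (i + 1)) :=
      div_pos (mul_pos (sub_pos.2 h3) hW) hW'
    have hle' : (K.f j (K.boundary s i) - K.c) * K.W (s i) / K.W (s (i + 1))
        ≤ K.f j (K.boundary s i) - K.c := by
      rw [div_le_iff₀ hW']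
      exact mul_le_mul_of_nonneg_left hle (sub_pos.2 h3).le
    have hp : K.c + (K.f j (K.boundary s i) - K.c) * K.W (s i) / K.W (s (i + 1)) ∈ K.prices :=
      hK.prices_interval.out hK.cost_mem (f_mem_prices h1) ⟨by linarith, by linarith⟩
    have hb : K.boundary s (i + 1) = K.g j
        (K.c + (K.f j (K.boundary s i) - K.c) * K.W (s i) / K.W (s (i + 1))) := by
      simp [boundary, Nat.lt_of_succ_lt hi, hj]
    have hm : K.boundary s (i + 1) ∈ K.penalties j := by rw [hb]; exact g_mem hp
    have hf : K.f j (K.boundary s (i + 1)) =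
        K.c + (K.f j (K.boundary s i) - K.c) * K.W (s i) / K.W (s (i + 1)) := by
      rw [hb, hK.f_g hp]
    have hv : K.boundary s (i + 1) ≤ K.v := by
      refine le_trans ?_ h2
      rw [← (hK.f_strictMonoOn j).le_iff_le hm h1, hf]
      linarith
    have := hK.mem_penalties_of_le (i := j) (j := ⟨i + 1, hi⟩) (Fin.le_def.2 (Nat.le_succ i)) hm
      (by rw [hf]; linarith) hv
    exact ⟨this.1, hv, this.2⟩

lemma value_pos (j : Fin n) : 0 < K.value s j :=
  mul_pos (sub_pos.2 (boundary_mem hK hs j).2.2) (hs.W_pos hK j)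

lemma price_mem (j : Fin n) {t : ℝ} (ht : t ∈ Set.Icc (s (j + 1)) (s j)) :
    K.c + K.value s j / K.W t ∈ K.prices ∧ 0 < K.W t ∧ t ∈ Set.Icc (0 : ℝ) 1 := by
  have ht' : t ∈ Set.Icc (0 : ℝ) 1 :=
    ⟨(hs.nonneg _).trans ht.1, ht.2.trans (hs.lt_one' _).le⟩
  have hW := hK.W_pos ht'.1 (ht.2.trans_lt (hs.lt_one' _))
  obtain ⟨h1, _, h3⟩ := boundary_mem hK hs j
  have hle := (hK.W_le_W_iff (hs.mem_Icc j) ht').2 ht.2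
  have hpos := div_pos (value_pos hK hs j) hW
  have hle' : K.value s j / K.W t ≤ K.f j (K.boundary s j) - K.c := by
    rw [div_le_iff₀ hW]
    exact mul_le_mul_of_nonneg_left hle (sub_pos.2 h3).le
  exact ⟨hK.prices_interval.out hK.cost_mem (f_mem_prices h1) ⟨by linarith, by linarith⟩, hW, ht'⟩

lemma quantile_mem (j : Fin n) {t : ℝ} (ht : t ∈ Set.Icc (s (j + 1)) (s j)) :
    K.quantile s j t ∈ K.penalties j := g_mem (price_mem hK hs j ht).1

lemma f_quantile (j : Fin n) {t : ℝ} (ht : t ∈ Set.Icc (s (j + 1)) (s j)) :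
    K.f j (K.quantile s j t) = K.c + K.value s j / K.W t := hK.f_g (price_mem hK hs j ht).1

lemma cost_lt_f_quantile (j : Fin n) {t : ℝ} (ht : t ∈ Set.Icc (s (j + 1)) (s j)) :
    K.c < K.f j (K.quantile s j t) := by
  rw [f_quantile hK hs j ht]
  have := div_pos (value_pos hK hs j) (price_mem hK hs j ht).2.1
  linarith

lemma pay_quantile (j : Fin n) {t : ℝ} (ht : t ∈ Set.Icc (s (j + 1)) (s j)) :
    K.pay j (K.quantile s j t) t = K.value s j := by
  rw [pay, f_quantile hK hs j ht, add_sub_cancel_left,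
    div_mul_cancel₀ _ (price_mem hK hs j ht).2.1.ne']

lemma quantile_strictMonoOn (j : Fin n) :
    StrictMonoOn (K.quantile s j) (Set.Icc (s (j + 1)) (s j)) := by
  intro t ht t' ht' h
  obtain ⟨h1, h2, h3⟩ := price_mem hK hs j ht
  obtain ⟨h1', h2', h3'⟩ := price_mem hK hs j ht'
  refine hK.strictMono j h1 h1' ?_
  have := div_lt_div_of_pos_left (value_pos hK hs j) h2' (hK.W_strictAntiOn h3 h3' h)
  linarith

lemma quantile_self (j : Fin n) : K.quantile s j (s j) = K.boundary s j := by
  have hW := (hs.W_pos hK j).ne'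
  rw [quantile, value, pay, mul_div_cancel_right₀ _ hW, add_sub_cancel,
    g_f (boundary_mem hK hs j).1]

lemma boundary_le_quantile (j : Fin n) {t : ℝ} (ht : t ∈ Set.Icc (s (j + 1)) (s j)) :
    K.boundary s (j + 1) ≤ K.quantile s j t := by
  rw [boundary_succ]
  exact (quantile_strictMonoOn hK hs j).monotoneOn (left_mem hs j) ht ht.1

lemma quantile_le_boundary (j : Fin n) {t : ℝ} (ht : t ∈ Set.Icc (s (j + 1)) (s j)) :
    K.quantile s j t ≤ K.boundary s j := by
  rw [← quantile_self hK hs]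
  exact (quantile_strictMonoOn hK hs j).monotoneOn ht (right_mem hs j) ht.2

lemma boundary_antitone : Antitone (K.boundary s) := by
  refine antitone_nat_of_succ_le fun i => ?_
  by_cases hi : i < n
  · exact (boundary_le_quantile hK hs ⟨i, hi⟩ (right_mem hs ⟨i, hi⟩)).trans_eq
      (quantile_self hK hs ⟨i, hi⟩)
  · simp [boundary, hi]

lemma boundary_le_v (i : ℕ) : K.boundary s i ≤ K.v := boundary_antitone hK hs (Nat.zero_le i)

lemma pay_boundary_succ (j : Fin n) : K.pay j (K.boundary s (j + 1)) (s (j + 1)) = K.value s j := by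
  rw [boundary_succ, pay_quantile hK hs j (left_mem hs j)]

/-- The values decrease when the loads increase. -/
lemma value_le (hs' : IsLoad s') (j : Fin n) (h : ∀ i : ℕ, i ≤ j → s' i ≤ s i) :
    K.value s j ≤ K.value s' j ∧ (s' j < s j → K.value s j < K.value s' j) := by
  obtain ⟨i, hi⟩ := j
  induction i with
  | zero =>
    have hA := sub_pos.2 (hK.cost_lt_f_v ⟨0, hi⟩)
    refine ⟨mul_le_mul_of_nonneg_left ?_ hA.le, fun hlt => mul_lt_mul_of_pos_left ?_ hA⟩
    · exact (hK.W_le_W_iff (hs.mem_Icc 0) (hs'.mem_Icc 0)).2 (h 0 le_rfl)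
    · exact hK.W_strictAntiOn (hs'.mem_Icc 0) (hs.mem_Icc 0) hlt
  | succ i ih =>
    have ih := (ih (Nat.lt_of_succ_lt hi) fun k hk => h k (Nat.le_succ_of_le hk)).1
    set j : Fin n := ⟨i, Nat.lt_of_succ_lt hi⟩ with hj
    obtain ⟨h1, h2, h3⟩ := boundary_mem hK hs ⟨i + 1, hi⟩
    obtain ⟨h1', h2', h3'⟩ := boundary_mem hK hs' ⟨i + 1, hi⟩
    have hW := hs.W_pos hK (i + 1)
    have hWle := (hK.W_le_W_iff (hs.mem_Icc (i + 1)) (hs'.mem_Icc (i + 1))).2 (h (i + 1) le_rfl)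
    rcases le_or_gt (K.boundary s (i + 1)) (K.boundary s' (i + 1)) with hle | hlt
    · have hf := sub_le_sub_right ((hK.f_strictMonoOn ⟨i + 1, hi⟩).monotoneOn h1 h1' hle) K.c
      refine ⟨mul_le_mul hf hWle hW.le (sub_pos.2 h3').le, fun hlt => ?_⟩
      exact mul_lt_mul' hf (hK.W_strictAntiOn (hs'.mem_Icc _) (hs.mem_Icc _) hlt) hW.le
        (sub_pos.2 h3')
    -- If the boundary is lower under `s'`, price and sale probability cannot be compared
    -- separately. But the previous state earns its value at each boundary, so by induction it
    -- weakly prefers the lower one, and single crossing makes this strict.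
    · have key : K.value s ⟨i + 1, hi⟩ < K.value s' ⟨i + 1, hi⟩ := by
        have hq : K.boundary s' (i + 1) = K.quantile s' j (s' (i + 1)) := boundary_succ j
        refine hK.single_crossing (i := j) (j := ⟨i + 1, hi⟩) (Fin.lt_def.2 (Nat.lt_succ_self i))
          ?_ ?_ hlt h2 (hs'.W_pos hK (i + 1)) ?_
        · rw [hq]; exact quantile_mem hK hs' j (left_mem hs' j)
        · rw [hq]; exact cost_lt_f_quantile hK hs' j (left_mem hs' j)
        · have e1 := pay_boundary_succ hK hs j
          have e2 := pay_boundary_succ hK hs' j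
          exact (e1.trans_le ih).trans_eq e2.symm
      exact ⟨key.le, fun _ => key⟩

end IsLoad

/-- The recursion for the boundaries composes `f`, `g` and `W`. Continuity of `f` and `g` enters
only from the second state on, where there are several states. -/
lemma IsLoad.continuousOn_value (hK : K.Admissible) {R : Set ℝ} {s : ℝ → ℕ → ℝ}
    (hs : ∀ r ∈ R, IsLoad (s r)) (hc : ∀ i, ContinuousOn (fun r => s r i) R) (j : Fin n) :
    ContinuousOn (fun r => K.value (s r) j) R := by
  have hW (i : ℕ) : ContinuousOn (fun r => K.W (s r i)) R :=
    K.continuous_W.comp_continuousOn (hc i)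
  suffices h : ContinuousOn (fun r => K.f j (K.boundary (s r) j)) R from
    (h.sub continuousOn_const).mul (hW j)
  obtain ⟨i, hi⟩ := j
  induction i with
  | zero =>
    change ContinuousOn (fun _ : ℝ => K.f ⟨0, hi⟩ K.v) R
    exact continuousOn_const
  | succ i ih =>
    have hn : 1 < n := by omega
    set j : Fin n := ⟨i, Nat.lt_of_succ_lt hi⟩ with hj
    have ih := ih (Nat.lt_of_succ_lt hi)
    have hp : ContinuousOn (fun r => K.c + K.value (s r) j / K.W (s r (i + 1))) R :=
      continuousOn_const.add (((ih.sub continuousOn_const).mul (hW i)).div (hW (i + 1))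
        fun r hr => ((hs r hr).W_pos hK (i + 1)).ne')
    refine (hK.continuousOn_f hn ⟨i + 1, hi⟩).comp (t := K.penalties ⟨i + 1, hi⟩) ?_
      fun r hr => (boundary_mem hK (hs r hr) ⟨i + 1, hi⟩).1
    have : (fun r => K.boundary (s r) (i + 1))
        = fun r => K.g j (K.c + K.value (s r) j / K.W (s r (i + 1))) := by
      funext r; exact boundary_succ j
    change ContinuousOn (fun r => K.boundary (s r) (i + 1)) R
    rw [this]
    exact (hK.continuous hn j).comp hp fun r hr =>
      (price_mem hK (hs r hr) j (left_mem (hs r hr) j)).1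

end Market
end

/-! ### Existence of the equilibrium at a node -/

noncomputable section
namespace Market

variable {n : ℕ} {K : Market n}

/-- Almost everywhere `f j` is bounded and agrees with a monotone function on the whole line, which
is measurable. -/
lemma Admissible.integrableOn_f (hK : K.Admissible) (j : Fin n) (μ : ProbabilityMeasure ℝ)
    (h : ∀ᵐ x ∂(μ : Measure ℝ), x ∈ K.penalties j ∧ x ≤ K.v ∧ K.c < K.f j x) :
    IntegrableOn (K.f j) (Set.Iic K.v) (μ : Measure ℝ) := by
  set A : Set ℝ := {x | x ∈ K.penalties j ∧ x ≤ K.v ∧ K.c < K.f j x} with hA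
  have hmono : MonotoneOn (K.f j) A :=
    (hK.f_strictMonoOn j).monotoneOn.mono fun x hx => hx.1
  have hbound (x : ℝ) (hx : x ∈ A) : K.f j x ∈ Set.Icc K.c (K.f j K.v) :=
    ⟨hx.2.2.le, hK.f_le_f_v hx.1 hx.2.1⟩
  obtain ⟨F, hF, hFA⟩ := hmono.exists_monotone_extension
    ⟨K.c, by rintro _ ⟨x, hx, rfl⟩; exact (hbound x hx).1⟩
    ⟨K.f j K.v, by rintro _ ⟨x, hx, rfl⟩; exact (hbound x hx).2⟩
  have hae : K.f j =ᵐ[(μ : Measure ℝ)] F := by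
    filter_upwards [h] with x hx using hFA hx
  refine Integrable.integrableOn ?_
  refine Integrable.of_mem_Icc K.c (K.f j K.v) (hF.measurable.aemeasurable.congr hae.symm) ?_
  filter_upwards [h] with x hx using hbound x hx

/-- The penalty distribution of a state: the image of a uniform distribution under the quantile
function. -/
lemma IsLoad.exists_penalty (hK : K.Admissible) {s : ℕ → ℝ} (hs : IsLoad s) (j : Fin n) :
    ∃ μ : ProbabilityMeasure ℝ,
      (∀ᵐ x ∂(μ : Measure ℝ), x ∈ K.penalties j ∧ x ≤ K.v ∧ K.c < K.f j x) ∧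
      (∀ A : Set ℝ, MeasurableSet A → (s j - s (j + 1)) * (μ : Measure ℝ).real A
        = volume.real (Set.Ioc (s (j + 1)) (s j) ∩ K.quantile s j ⁻¹' A)) ∧
      (s (j + 1) < s j → ∀ᵐ x ∂(μ : Measure ℝ),
        ∃ t ∈ Set.Ioc (s (j + 1)) (s j), K.quantile s j t = x) := by
  rcases (hs.antitone (Nat.le_succ j)).eq_or_lt with heq | hlt
  -- A state with zero load is immaterial; any admissible law serves.
  · refine ⟨⟨Measure.dirac K.v, inferInstance⟩, ?_, fun A _ => ?_, fun h => absurd heq h.ne⟩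
    · change ∀ᵐ x ∂(Measure.dirac K.v), _
      rw [ae_dirac_eq]
      exact ⟨hK.v_mem j, le_rfl, hK.cost_lt_f_v j⟩
    · have : s (j + 1) = s j := heq
      simp [this]
  have hmono := (IsLoad.quantile_strictMonoOn hK hs j).monotoneOn
  -- The quantile function is monotone only on its block; a globally monotone extension makes it
  -- measurable.
  obtain ⟨Q, hQ, hQe⟩ := hmono.exists_monotone_extension
    ⟨K.boundary s (j + 1), by rintro _ ⟨t, ht, rfl⟩; exact boundary_le_quantile hK hs j ht⟩
    ⟨K.boundary s j, by rintro _ ⟨t, ht, rfl⟩; exact quantile_le_boundary hK hs j ht⟩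
  have hvol : volume (Set.Ioc (s (j + 1)) (s j)) = ENNReal.ofReal (s j - s (j + 1)) :=
    Real.volume_Ioc
  have hpos : 0 < s j - s (j + 1) := sub_pos.2 hlt
  have hvol0 : volume (Set.Ioc (s (j + 1)) (s j)) ≠ 0 := by simpa [hvol] using hlt
  have hvolt : volume (Set.Ioc (s (j + 1)) (s j)) ≠ ⊤ := by simp [hvol]
  set P : Measure ℝ := ProbabilityTheory.cond volume (Set.Ioc (s (j + 1)) (s j)) with hP
  have hprob : IsProbabilityMeasure P :=
    ProbabilityTheory.cond_isProbabilityMeasure_of_finite hvol0 hvolt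
  have hprob' : IsProbabilityMeasure (P.map Q) :=
    Measure.isProbabilityMeasure_map hQ.measurable.aemeasurable
  have hmem : ∀ᵐ x ∂(P.map Q), ∃ t ∈ Set.Ioc (s (j + 1)) (s j), K.quantile s j t = x := by
    have h1 : ∀ᵐ t ∂P, t ∈ Set.Ioc (s (j + 1)) (s j) :=
      ProbabilityTheory.ae_cond_mem measurableSet_Ioc
    have hinj : Set.InjOn Q (Set.Ioc (s (j + 1)) (s j)) := by
      intro t ht u hu htu
      have ht' := Set.Ioc_subset_Icc_self ht
      have hu' := Set.Ioc_subset_Icc_self hu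
      rw [← hQe ht', ← hQe hu'] at htu
      exact (quantile_strictMonoOn hK hs j).injOn ht' hu' htu
    have himage : MeasurableSet (Q '' Set.Ioc (s (j + 1)) (s j)) :=
      measurableSet_Ioc.image_of_measurable_injOn hQ.measurable hinj
    have h2 : ∀ᵐ x ∂(P.map Q), x ∈ Q '' Set.Ioc (s (j + 1)) (s j) := by
      refine (ae_map_iff hQ.measurable.aemeasurable himage).2 ?_
      filter_upwards [h1] with t ht using Set.mem_image_of_mem Q ht
    filter_upwards [h2] with x hx
    obtain ⟨t, ht, rfl⟩ := hx
    exact ⟨t, ht, hQe (Set.Ioc_subset_Icc_self ht)⟩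
  refine ⟨⟨P.map Q, hprob'⟩, ?_, fun A hA => ?_, fun _ => hmem⟩
  · filter_upwards [hmem] with x hx
    obtain ⟨t, ht, rfl⟩ := hx
    have ht' := Set.Ioc_subset_Icc_self ht
    exact ⟨quantile_mem hK hs j ht', (quantile_le_boundary hK hs j ht').trans
      (boundary_le_v hK hs j), cost_lt_f_quantile hK hs j ht'⟩
  · change _ * (P.map Q).real A = _
    have hset : Set.Ioc (s (j + 1)) (s j) ∩ Q ⁻¹' A
        = Set.Ioc (s (j + 1)) (s j) ∩ K.quantile s j ⁻¹' A := by
      ext t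
      refine and_congr_right fun ht => ?_
      rw [Set.mem_preimage, Set.mem_preimage, hQe (Set.Ioc_subset_Icc_self ht)]
    rw [Measure.real, Measure.map_apply hQ.measurable hA, hP,
      ProbabilityTheory.cond_apply measurableSet_Ioc, hset, ENNReal.toReal_mul, hvol,
      ENNReal.toReal_inv, ENNReal.toReal_ofReal hpos.le, ← mul_assoc, mul_inv_cancel₀ hpos.ne',
      one_mul, Measure.real]

lemma isLoad_tail (hK : K.Admissible) {α : Fin n → ℝ} (h0 : ∀ j, 0 ≤ α j) (h1 : ∀ j, α j ≤ 1) :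
    IsLoad (K.tail α) :=
  ⟨tail_nonneg hK h0, tail_antitone hK h0, tail_zero_lt_one hK h1⟩

section

variable {s : ℕ → ℝ}

/-- Each intermediate state is indifferent between the two ends of its block, so the better state
`j` prefers the lower end. The steps chain down to the block of `j`. -/
lemma IsLoad.pay_boundary_le_of_le (hK : K.Admissible) (hs : IsLoad s) {j : Fin n} {i : ℕ}
    (hij : i ≤ j) : K.pay j (K.boundary s i) (s i) ≤ K.value s j := by
  induction hij using Nat.decreasingInduction with
  | self => exact le_rfl
  | of_succ k hk ih =>
    refine le_trans ?_ ih
    set i : Fin n := ⟨k, hk.trans j.2⟩ with hi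
    refine hK.pay_le_of_le (i := i) (Fin.le_def.2 hk.le) ?_ ?_
      (boundary_antitone hK hs (Nat.le_succ k)) (boundary_le_v hK hs k) (hs.W_pos hK _) ?_
    · have := quantile_mem hK hs i (hs.left_mem i)
      rwa [← boundary_succ] at this
    · have := cost_lt_f_quantile hK hs i (hs.left_mem i)
      rwa [← boundary_succ] at this
    · exact (pay_boundary_succ hK hs i).ge

/-- Below its own block, state `j` cannot gain by passing to the lower end of a better state's
block: a strict gain would be a strict gain for that state too, which is indifferent. The profitable
`x` below makes these boundaries available in state `j`. -/
lemma IsLoad.pay_boundary_le_of_lt (hK : K.Admissible) (hs : IsLoad s) {j : Fin n} {i : ℕ}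
    (hij : j + 1 ≤ i) (hi : i < n) {x : ℝ} (hx : x ∈ K.penalties j) (hxc : K.c < K.f j x)
    (hxi : x ≤ K.boundary s i) : K.pay j (K.boundary s i) (s i) ≤ K.value s j := by
  have hn : 1 < n := by omega
  have hgx := (hK.cost_lt_f_iff hx).1 hxc
  induction i, hij using Nat.le_induction with
  | base => exact (pay_boundary_succ hK hs j).le
  | succ k hk ih =>
    have hb := boundary_antitone hK hs (Nat.le_succ k)
    refine le_trans ?_ (ih (Nat.lt_of_succ_lt hi) (hxi.trans hb))
    set i : Fin n := ⟨k, Nat.lt_of_succ_lt hi⟩ with hi'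
    by_contra! hcon
    have hm := hK.mem_penalties hn (j := j) (hgx.le.trans hxi) (boundary_le_v hK hs _)
    have := hK.pay_lt_of_le (i := j) (j := i) (Fin.le_def.2 (by simp [hi']; omega)) hm
      ((hK.cost_lt_f_iff hm).2 (hgx.trans_le hxi)) hb (boundary_le_v hK hs k) (hs.W_pos hK _) hcon
    exact absurd (pay_boundary_succ hK hs i) this.ne'

lemma IsLoad.pay_quantile_le (hK : K.Admissible) (hs : IsLoad s) {i j : Fin n} {t : ℝ}
    (ht : t ∈ Set.Icc (s (i + 1)) (s i)) (hx : K.quantile s i t ∈ K.penalties j)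
    (hxc : K.c < K.f j (K.quantile s i t)) : K.pay j (K.quantile s i t) t ≤ K.value s j := by
  have hqb := quantile_le_boundary hK hs i ht
  have hbv := boundary_le_v hK hs i
  rcases lt_trichotomy i j with hij | rfl | hij
  · refine le_trans ?_ (hs.pay_boundary_le_of_le hK (Fin.lt_def.1 hij))
    refine hK.pay_le_of_le (i := i) hij.le ?_ ?_ (boundary_le_quantile hK hs i ht)
      (hqb.trans hbv) (hs.W_pos hK _) ?_
    · rw [boundary_succ]; exact quantile_mem hK hs i (hs.left_mem i)
    · rw [boundary_succ]; exact cost_lt_f_quantile hK hs i (hs.left_mem i)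
    · rw [pay_boundary_succ hK hs, pay_quantile hK hs i ht]
  · exact (pay_quantile hK hs i ht).le
  · refine le_trans ?_ (hs.pay_boundary_le_of_lt hK (Fin.lt_def.1 hij) i.2 hx hxc hqb)
    by_contra! hcon
    have := hK.pay_lt_of_le hij.le hx hxc hqb hbv (price_mem hK hs i ht).2.1 hcon
    rw [pay_quantile hK hs i ht] at this
    exact lt_irrefl _ this

lemma IsLoad.exists_quantile_eq (hK : K.Admissible) (hs : IsLoad s) {j : Fin n} {x : ℝ}
    (hx : x ∈ K.penalties j) (hxv : x ≤ K.v) (hxn : K.boundary s n ≤ x) :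
    ∃ i : Fin n, ∃ t ∈ Set.Icc (s (i + 1)) (s i), K.quantile s i t = x := by
  obtain ⟨i, h1, h2⟩ : ∃ i : Fin n, K.boundary s (i + 1) ≤ x ∧ x ≤ K.boundary s i := by
    by_contra! hcon
    have : ∀ i ≤ n, x ≤ K.boundary s i := by
      intro i
      induction i with
      | zero => intro _; exact hxv
      | succ i ih =>
        intro hi
        by_contra! hlt
        exact absurd (ih (by omega)) (not_le.2 (hcon ⟨i, hi⟩ hlt.le))
    have hnpos : n - 1 + 1 = n := by have := j.2; omega
    have h := hcon ⟨n - 1, by have := j.2; omega⟩ (by rwa [hnpos])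
    exact absurd (this (n - 1) (by omega)) (not_le.2 h)
  refine ⟨i, ?_⟩
  have hml := quantile_mem hK hs i (hs.left_mem i)
  have hcl := cost_lt_f_quantile hK hs i (hs.left_mem i)
  rw [← boundary_succ] at hml hcl
  have hxi : x ∈ K.penalties i := by
    rcases eq_or_ne i j with rfl | hij
    · exact hx
    · have hn : 1 < n := by
        have := i.2; have := j.2
        have : (i : ℕ) ≠ j := fun h => hij (Fin.ext h)
        omega
      exact hK.mem_penalties hn (((hK.cost_lt_f_iff hml).1 hcl).le.trans h1) hxv
  obtain ⟨hmr, -, -⟩ := boundary_mem hK hs i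
  have hf1 := (hK.f_strictMonoOn i).monotoneOn hml hxi h1
  have hf2 := (hK.f_strictMonoOn i).monotoneOn hxi hmr h2
  have hxc : 0 < K.f i x - K.c := sub_pos.2 (hcl.trans_le hf1)
  have hpl := pay_boundary_succ hK hs i
  have hW1 := hs.W_pos hK (i + 1)
  have hW2 := hs.W_pos hK i
  -- The level `t` is the load at which state `i` would earn exactly its value at `x`; it exists
  -- because `x` lies between the block ends.
  obtain ⟨t, ht, hWt⟩ := intermediate_value_Icc' (hs.antitone (Nat.le_succ i))
    K.continuous_W.continuousOn (show K.value s i / (K.f i x - K.c) ∈ _ from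
      ⟨by
        rw [le_div_iff₀ hxc, value, pay, mul_comm]
        exact mul_le_mul_of_nonneg_right (by linarith) hW2.le,
      by
        rw [div_le_iff₀ hxc, ← hpl, pay, mul_comm]
        exact mul_le_mul_of_nonneg_left (by linarith) hW1.le⟩)
  refine ⟨t, ht, ?_⟩
  rw [quantile, hWt, div_div_cancel₀ (value_pos hK hs i).ne', add_sub_cancel, g_f hxi]

end

section

variable {α : Fin n → ℝ} {μ : Fin n → ProbabilityMeasure ℝ}

/-- The offers below the penalty at level `t` have probability `t`. -/
lemma load_Iic_quantile (hK : K.Admissible) (h0 : ∀ j, 0 ≤ α j) (h1 : ∀ j, α j ≤ 1)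
    (hμ : ∀ j, ∀ A : Set ℝ, MeasurableSet A → K.q j * α j * (μ j : Measure ℝ).real A
      = volume.real (Set.Ioc (K.tail α (j + 1)) (K.tail α j) ∩ K.quantile (K.tail α) j ⁻¹' A))
    (i : Fin n) {t : ℝ} (ht : t ∈ Set.Icc (K.tail α (i + 1)) (K.tail α i)) :
    K.load α μ (Set.Iic (K.quantile (K.tail α) i t)) = t := by
  have hs := isLoad_tail hK h0 h1
  set x := K.quantile (K.tail α) i t with hx
  -- Worse states contribute nothing, better ones their full load, and state `i` the part of its
  -- block up to level `t`.
  have hterm (k : Fin n) : K.q k * α k * (μ k : Measure ℝ).real (Set.Iic x)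
      = (if (i : ℕ) + 1 ≤ k then K.q k * α k else 0)
        + if k = i then t - K.tail α (i + 1) else 0 := by
    rw [hμ k _ measurableSet_Iic]
    rcases lt_trichotomy k i with hki | rfl | hik
    · have hki' := Fin.lt_def.1 hki
      rw [if_neg (by omega), if_neg hki.ne, add_zero]
      convert measureReal_empty
      rw [Set.eq_empty_iff_forall_notMem]
      rintro u ⟨hu, hux⟩
      have h2 := IsLoad.quantile_strictMonoOn hK hs k (hs.left_mem k)
        (Set.Ioc_subset_Icc_self hu) hu.1
      rw [← IsLoad.boundary_succ] at h2
      have h3 := IsLoad.boundary_antitone hK hs (show (k : ℕ) + 1 ≤ i from hki')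
      have h4 := IsLoad.quantile_le_boundary hK hs i ht
      exact absurd (Set.mem_Iic.1 hux) (not_le.2 (h4.trans_lt (h3.trans_lt h2)))
    · rw [if_neg (by omega), if_pos rfl, zero_add]
      have : Set.Ioc (K.tail α (k + 1)) (K.tail α k) ∩ K.quantile (K.tail α) k ⁻¹' Set.Iic x
          = Set.Ioc (K.tail α (k + 1)) t := by
        ext u
        constructor
        · rintro ⟨hu, hux⟩
          exact ⟨hu.1, ((IsLoad.quantile_strictMonoOn hK hs k).le_iff_le
            (Set.Ioc_subset_Icc_self hu) ht).1 hux⟩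
        · intro hu
          have hu' : u ∈ Set.Ioc (K.tail α (k + 1)) (K.tail α k) := ⟨hu.1, hu.2.trans ht.2⟩
          exact ⟨hu', ((IsLoad.quantile_strictMonoOn hK hs k).le_iff_le
            (Set.Ioc_subset_Icc_self hu') ht).2 hu.2⟩
      rw [this, Real.volume_real_Ioc_of_le ht.1]
    · have hik' := Fin.lt_def.1 hik
      rw [if_pos (by omega), if_neg hik.ne', add_zero]
      have : Set.Ioc (K.tail α (k + 1)) (K.tail α k) ∩ K.quantile (K.tail α) k ⁻¹' Set.Iic x
          = Set.Ioc (K.tail α (k + 1)) (K.tail α k) := by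
        refine Set.inter_eq_left.2 fun u hu => ?_
        have h2 := IsLoad.quantile_le_boundary hK hs k (Set.Ioc_subset_Icc_self hu)
        have h3 := IsLoad.boundary_antitone hK hs (show (i : ℕ) + 1 ≤ k from hik')
        have h4 := IsLoad.boundary_le_quantile hK hs i ht
        exact h2.trans (h3.trans h4)
      rw [this, Real.volume_real_Ioc_of_le (hs.antitone (Nat.le_succ _)), tail_succ_add k,
        add_sub_cancel_right]
  rw [load, Finset.sum_congr rfl fun k _ => hterm k, Finset.sum_add_distrib, ← Finset.sum_filter,
    Finset.sum_ite_eq' Finset.univ i, if_pos (Finset.mem_univ i)]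
  exact add_sub_cancel _ _

/-- Every vector of offer probabilities has an equilibrium at a single node. -/
theorem exists_nodeEq (hK : K.Admissible) (h0 : ∀ j, 0 ≤ α j) (h1 : ∀ j, α j ≤ 1) :
    ∃ μ : Fin n → ProbabilityMeasure ℝ, NodeEq K α μ (K.value (K.tail α)) ∧
      ∀ j, ∀ᵐ x ∂(μ j : Measure ℝ), x ∈ K.penalties j ∧ x ≤ K.v ∧ K.c < K.f j x := by
  have hs := isLoad_tail hK h0 h1
  choose μ hmem hreal hq using hs.exists_penalty hK
  have hreal' : ∀ j, ∀ A : Set ℝ, MeasurableSet A → K.q j * α j * (μ j : Measure ℝ).real A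
      = volume.real (Set.Ioc (K.tail α (j + 1)) (K.tail α j)
        ∩ K.quantile (K.tail α) j ⁻¹' A) := by
    intro j A hA
    rw [← hreal j A hA, tail_succ_add j, add_sub_cancel_right]
  have hload := fun (i : Fin n) (t : ℝ) (ht : t ∈ Set.Icc (K.tail α (i + 1)) (K.tail α i)) =>
    load_Iic_quantile hK h0 h1 hreal' i ht
  have hquant : ∀ i j : Fin n, ∀ t ∈ Set.Icc (K.tail α (i + 1)) (K.tail α i),
      K.quantile (K.tail α) i t ∈ K.penalties j → K.c < K.f j (K.quantile (K.tail α) i t) →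
      (K.f j (K.quantile (K.tail α) i t) - K.c)
        * K.W (K.load α μ (Set.Iic (K.quantile (K.tail α) i t))) ≤ K.value (K.tail α) j := by
    intro i j t ht hx hxc
    rw [hload i t ht]
    exact hs.pay_quantile_le hK ht hx hxc
  refine ⟨μ, ⟨h0, h1, fun x => ?_, fun j x hx hxv => ?_, fun j ε hε => ?_, fun j hj => ?_⟩, hmem⟩
  · refine Finset.sum_eq_zero fun j _ => ?_
    rw [hreal' j _ (measurableSet_singleton x)]
    have : (Set.Ioc (K.tail α (j + 1)) (K.tail α j)
        ∩ K.quantile (K.tail α) j ⁻¹' {x}).Subsingleton := by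
      rintro u ⟨hu, hux⟩ u' ⟨hu', hux'⟩
      exact (IsLoad.quantile_strictMonoOn hK hs j).injOn (Set.Ioc_subset_Icc_self hu)
        (Set.Ioc_subset_Icc_self hu') (Eq.trans hux (Eq.symm hux'))
    rw [Measure.real, this.measure_zero, ENNReal.toReal_zero]
  · rcases le_or_gt (K.f j x) K.c with hxc | hxc
    · exact (mul_nonpos_of_nonpos_of_nonneg (sub_nonpos.2 hxc)
        (W_load_pos hK h0 h1 _).le).trans (IsLoad.value_pos hK hs j).le
    rcases le_or_gt (K.boundary (K.tail α) n) x with hxn | hxn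
    · obtain ⟨i, t, ht, rfl⟩ := hs.exists_quantile_eq hK hx hxv hxn
      exact hquant i j t ht hx hxc
    -- Below every block a sale is already certain at the lowest boundary, where `W 0 = 1` and the
    -- price is higher.
    · set i : Fin n := ⟨n - 1, by have := j.2; omega⟩ with hi
      have hin : (i : ℕ) + 1 = n := by have := j.2; simp only [hi]; omega
      have hb : K.boundary (K.tail α) n = K.quantile (K.tail α) i (K.tail α (i + 1)) := by
        rw [← IsLoad.boundary_succ, hin]
      have hm : K.boundary (K.tail α) n ∈ K.penalties j := by
        -- With several states, continuity makes this boundary a penalty of state `j`. With one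
        -- state, the boundary is a quantile of that state.
        by_cases hn : 1 < n
        · exact hK.mem_penalties hn (((hK.cost_lt_f_iff hx).1 hxc).trans hxn).le
            (IsLoad.boundary_le_v hK hs n)
        · have : j = i := Fin.ext (by have := j.2; omega)
          rw [hb, this]
          exact IsLoad.quantile_mem hK hs i (hs.left_mem i)
      have hlt := hK.f_strictMonoOn j hx hm hxn
      have h2 := hquant i j _ (hs.left_mem i)
      rw [hload i _ (hs.left_mem i), ← hb, hin, tail_of_le le_rfl, hK.W_zero, mul_one] at h2
      refine le_trans ?_ (h2 hm (hxc.trans hlt))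
      refine le_trans (mul_le_of_le_one_right (sub_pos.2 hxc).le
        (hK.W_le_one (load_nonneg hK h0 _) (load_mem_Icc hK h0 h1 _).2)) ?_
      linarith
  · obtain ⟨hb1, hb2, -⟩ := IsLoad.boundary_mem hK hs j
    refine ⟨_, hb1, hb2, ?_⟩
    have := hload j _ (hs.right_mem j)
    rw [IsLoad.quantile_self hK hs] at this
    rw [this]
    exact sub_lt_self _ hε
  · have hlt : K.tail α (j + 1) < K.tail α j := by
      rw [tail_succ_add j]
      exact lt_add_of_pos_left _ (mul_pos (hK.q_pos j) hj)
    filter_upwards [hq j hlt, hmem j] with x hx hxm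
    obtain ⟨t, ht, rfl⟩ := hx
    have ht' := Set.Ioc_subset_Icc_self ht
    refine ⟨hxm.1, hxm.2.1, ?_⟩
    rw [hload j t ht']
    exact IsLoad.pay_quantile hK hs j ht'

end

lemma NodeEq.U_eq_value (hK : K.Admissible) {α : Fin n → ℝ} {μ : Fin n → ProbabilityMeasure ℝ}
    {U : Fin n → ℝ} (h : NodeEq K α μ U) : U = K.value (K.tail α) := by
  obtain ⟨μ', h', -⟩ := exists_nodeEq hK h.nonneg h.le_one
  exact h.U_eq hK h'

end Market
end

/-! ### Symmetric Nash equilibria as node equilibria -/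

noncomputable section
namespace Market

variable {n : ℕ} {K : Market n}

/-- The probability that an offer at penalty `x` is sold. -/
def share (K : Market n) (α : Fin n → ℝ) (μ : Fin n → ProbabilityMeasure ℝ) (x : ℝ) : ℝ :=
  tieWin (Fin (K.l - 1)) K.m (rankWeights (K.load α μ (Set.Iio x)) (K.load α μ {x}))

section Share

variable {α : Fin n → ℝ} {μ : Fin n → ProbabilityMeasure ℝ}

lemma load_Iic (x : ℝ) :
    K.load α μ (Set.Iic x) = K.load α μ (Set.Iio x) + K.load α μ {x} := by
  unfold load
  rw [← Finset.sum_add_distrib]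
  refine Finset.sum_congr rfl fun j _ => ?_
  rw [← mul_add, ← measureReal_union (by simp) (measurableSet_singleton x), Set.Iio_union_right]

lemma load_add_le_one (hK : K.Admissible) (h0 : ∀ j, 0 ≤ α j) (h1 : ∀ j, α j ≤ 1) (x : ℝ) :
    K.load α μ (Set.Iio x) + K.load α μ {x} ≤ 1 := by
  rw [← load_Iic]; exact (load_mem_Icc hK h0 h1 _).2

lemma W_load_Iic_le_share (hK : K.Admissible) (h0 : ∀ j, 0 ≤ α j) (h1 : ∀ j, α j ≤ 1) (x : ℝ) :
    K.W (K.load α μ (Set.Iic x)) ≤ K.share α μ x := by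
  rw [load_Iic]
  exact tieWin_add_le _ (load_nonneg hK h0 _) (load_nonneg hK h0 _) (load_add_le_one hK h0 h1 x)

lemma share_le_one (hK : K.Admissible) (h0 : ∀ j, 0 ≤ α j) (h1 : ∀ j, α j ≤ 1) (x : ℝ) :
    K.share α μ x ≤ 1 :=
  (tieWin_le _ (load_nonneg hK h0 _) (load_nonneg hK h0 _) (load_add_le_one hK h0 h1 x)).trans
    (hK.W_le_one (load_nonneg hK h0 _) (load_mem_Icc hK h0 h1 _).2)

lemma share_pos (hK : K.Admissible) (h0 : ∀ j, 0 ≤ α j) (h1 : ∀ j, α j ≤ 1) (x : ℝ) :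
    0 < K.share α μ x :=
  (W_load_pos hK h0 h1 _).trans_le (W_load_Iic_le_share hK h0 h1 x)

lemma share_lt (hK : K.Admissible) (h0 : ∀ j, 0 ≤ α j) (h1 : ∀ j, α j ≤ 1) {x : ℝ}
    (hx : 0 < K.load α μ {x}) : K.share α μ x < K.W (K.load α μ (Set.Iio x)) := by
  have := hK.m_lt_l
  exact tieWin_lt _ (load_nonneg hK h0 _) hx (load_add_le_one hK h0 h1 x) hK.one_le_m
    (by simp; omega)

lemma share_eq_W {x : ℝ} (hx : K.load α μ {x} = 0) :
    K.share α μ x = K.W (K.load α μ (Set.Iic x)) := by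
  rw [load_Iic, share, hx, add_zero]
  rfl

/-- There are no ties in an equilibrium: undercutting a tie is profitable. -/
lemma load_singleton_eq_zero (hK : K.Admissible) (h0 : ∀ j, 0 ≤ α j) (h1 : ∀ j, α j ≤ 1)
    {U : Fin n → ℝ} (hU : ∀ j, 0 < U j)
    (hle : ∀ j, ∀ x ∈ K.penalties j, x ≤ K.v → (K.f j x - K.c) * K.share α μ x ≤ U j)
    (hbest : ∀ j, 0 < α j → ∀ᵐ x ∂(μ j : Measure ℝ), x ∈ K.penalties j ∧ x ≤ K.v ∧
      (K.f j x - K.c) * K.share α μ x = U j) (x : ℝ) : K.load α μ {x} = 0 := by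
  by_contra hne
  have hpos : 0 < K.load α μ {x} := (load_nonneg hK h0 _).lt_of_ne' hne
  obtain ⟨j, -, hj⟩ := Finset.exists_ne_zero_of_sum_ne_zero hne
  have hαj : 0 < α j := (h0 j).lt_of_ne' fun h => hj (by rw [h]; simp)
  obtain ⟨hx, hxv, hxU⟩ : x ∈ K.penalties j ∧ x ≤ K.v ∧
      (K.f j x - K.c) * K.share α μ x = U j := by
    by_contra hcon
    refine hj ?_
    have : (μ j : Measure ℝ) {x} = 0 :=
      measure_mono_null (by rintro _ rfl; exact hcon) (ae_iff.1 (hbest j hαj))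
    rw [Measure.real, this]; simp
  have hshare := share_pos (μ := μ) hK h0 h1 x
  have hlt := share_lt (μ := μ) hK h0 h1 hpos
  have hxc : 0 < K.f j x - K.c := by
    have := hU j
    rw [← hxU] at this
    exact (mul_pos_iff_of_pos_right hshare).1 this
  set w := K.W (K.load α μ (Set.Iio x)) with hw
  have hwpos : 0 < w := hshare.trans hlt
  -- A margin `p` in this gap undercuts the tie, sells with probability at least `w`, and so earns
  -- more than `U j`.
  have h2 : U j / w < K.f j x - K.c := by
    rw [div_lt_iff₀ hwpos, ← hxU]
    exact mul_lt_mul_of_pos_left hlt hxc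
  obtain ⟨p, hp1, hp2⟩ := exists_between h2
  have hp0 : 0 < p := (div_pos (hU j) hwpos).trans hp1
  have hp : K.c + p ∈ K.prices :=
    hK.prices_interval.out hK.cost_mem (f_mem_prices hx) ⟨by linarith, by linarith⟩
  have hgx : K.g j (K.c + p) < x := by
    rw [← (hK.f_strictMonoOn j).lt_iff_lt (g_mem hp) hx, hK.f_g hp]
    linarith
  have h3 := hle j _ (g_mem hp) (hgx.le.trans hxv)
  rw [hK.f_g hp, add_sub_cancel_left] at h3
  have h4 : w ≤ K.share α μ (K.g j (K.c + p)) := by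
    refine le_trans ?_ (W_load_Iic_le_share hK h0 h1 _)
    exact (hK.W_le_W_iff (load_mem_Icc hK h0 h1 _) (load_mem_Icc hK h0 h1 _)).2
      (load_mono hK h0 fun y hy => lt_of_le_of_lt hy hgx)
  have h5 := mul_le_mul_of_nonneg_left h4 hp0.le
  rw [div_lt_iff₀ hwpos] at hp1
  linarith

end Share

variable {V : Type*} [Fintype V] [DecidableEq V] {G : SimpleGraph V}

lemma StateStrategy.nodeProb_nonneg {j : Fin n} (ψ : K.StateStrategy G j) (a : V) :
    0 ≤ ψ.nodeProb a := Finset.sum_nonneg fun I _ => ψ.select_nonneg I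

lemma StateStrategy.nodeProb_le_one {j : Fin n} (ψ : K.StateStrategy G j) (a : V) :
    ψ.nodeProb a ≤ 1 := by
  rw [← ψ.select_sum]
  exact Finset.sum_le_sum_of_subset_of_nonneg (Finset.filter_subset _ _)
    fun I _ _ => ψ.select_nonneg I

lemma StateStrategy.nodeProb_pos {j : Fin n} (ψ : K.StateStrategy G j) {a : V} {I : Finset V}
    (hI : ψ.select I ≠ 0) (ha : a ∈ I) : 0 < ψ.nodeProb a :=
  Finset.sum_pos' (fun I _ => ψ.select_nonneg I)
    ⟨I, by simpa using ha, (ψ.select_nonneg I).lt_of_ne' hI⟩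

/-- The probability of being sold at node `a` at penalty `x` when all others use `T`. -/
abbrev nodeShare (T : K.Strategy G) (a : V) (x : ℝ) : ℝ :=
  K.share (fun j => (T j).nodeProb a) (fun j => (T j).penalty a) x

lemma winProb_eq_share {S : K.Profile G} {T : K.Strategy G} (hS : ∀ k, S k = T) (i : Fin K.l)
    (a : V) (x : ℝ) : winProb S i a x = nodeShare T a x := by
  have hcard : Fintype.card {k : Fin K.l // k ≠ i} = K.l - 1 := by simp
  have hrank : rankProb T a x = rankWeights (offerProb T a (Set.Iio x)) (offerProb T a {x}) := by
    funext o
    cases o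
    · rfl
    · rfl
    · exact congrArg (1 - ·) (load_Iic x)
  have h1 : winProb S i a x = tieWin {k : Fin K.l // k ≠ i} K.m (rankProb T a x) := by
    simp only [winProb, tieWin, hS]
  rw [h1, hrank, tieWin_congr_equiv (Fintype.equivFinOfCardEq hcard)]
  rfl

lemma nodePayoff_eq {S : K.Profile G} {T : K.Strategy G} (hS : ∀ k, S k = T) (i : Fin K.l)
    (j : Fin n) (a : V) (x : ℝ) :
    nodePayoff S i j a x = if x ≤ K.v then (K.f j x - K.c) * nodeShare T a x else 0 := by
  rw [nodePayoff, winProb_eq_share hS]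

lemma integral_nodePayoff_le {S : K.Profile G} {i : Fin K.l} {j : Fin n} {a : V}
    (ψ : K.StateStrategy G j) {u : ℝ} (hu : 0 ≤ u)
    (h : ∀ x ∈ K.penalties j, x ≤ K.v → nodePayoff S i j a x ≤ u) :
    ∫ x, nodePayoff S i j a x ∂(ψ.penalty a : Measure ℝ) ≤ u := by
  by_cases hint : Integrable (fun x => nodePayoff S i j a x) (ψ.penalty a : Measure ℝ)
  · calc _ ≤ ∫ _, u ∂(ψ.penalty a : Measure ℝ) := by
          refine integral_mono_ae hint (integrable_const u) ?_
          filter_upwards [ψ.penalty_mem a] with x hx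
          by_cases hxv : x ≤ K.v
          · exact h x hx hxv
          · simpa [nodePayoff, hxv] using hu
      _ = u := by simp
  -- A nonintegrable payoff has integral `0` by convention, which `u` bounds as well.
  · rwa [integral_undef hint]

/-- The deviation that selects `I` and offers at fixed penalties. -/
def pureStrategy (j : Fin n) (I : Finset V) (hI : G.IsIndepSet (I : Set V))
    (x : V → ℝ) (hx : ∀ a, x a ∈ K.penalties j) : K.StateStrategy G j where
  select := fun J => if J = I then 1 else 0
  select_nonneg := fun J => by split_ifs <;> norm_num
  select_sum := by simp
  select_indep := fun J hJ => by
    have : J = I := by by_contra h; simp [h] at hJ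
    rwa [this]
  penalty := fun a => ⟨Measure.dirac (x a), inferInstance⟩
  penalty_mem := fun a => by
    change ∀ᵐ y ∂(Measure.dirac (x a)), _
    rw [ae_dirac_eq]
    exact hx a
  integrable := fun _ => (integrable_dirac (by simp)).integrableOn

lemma payoff_pureStrategy (S : K.Profile G) (i : Fin K.l) (j : Fin n)
    (I : Finset V) (hI : G.IsIndepSet (I : Set V)) (x : V → ℝ) (hx : ∀ a, x a ∈ K.penalties j) :
    payoff S i j (pureStrategy j I hI x hx) = ∑ a ∈ I, nodePayoff S i j a (x a) := by
  rw [payoff, Finset.sum_eq_single I]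
  · simp only [pureStrategy, if_pos, one_mul]
    refine Finset.sum_congr rfl fun a _ => ?_
    exact integral_dirac _ _
  · intro J _ hJ
    simp [pureStrategy, hJ]
  · simp

/-- In a symmetric equilibrium every node is in equilibrium, and the selected independent sets
have the largest total payoff. -/
theorem IsSymmetricNE.exists_nodeEq (hK : K.Admissible) {S : K.Profile G} (hS : IsSymmetricNE S)
    {T : K.Strategy G} (hT : ∀ k, S k = T) :
    ∃ U : V → Fin n → ℝ,
      (∀ a, NodeEq K (fun j => (T j).nodeProb a) (fun j => (T j).penalty a) (U a)) ∧
      ∀ j I, (T j).select I ≠ 0 → ∀ J : Finset V, G.IsIndepSet (J : Set V) →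
        ∑ a ∈ J, U a j ≤ ∑ a ∈ I, U a j := by
  have i : Fin K.l := ⟨0, by have := hK.m_lt_l; omega⟩
  have h0 (a : V) (j : Fin n) := (T j).nodeProb_nonneg a
  have h1 (a : V) (j : Fin n) := (T j).nodeProb_le_one a
  set A : V → Fin n → Set ℝ := fun a j =>
    (fun x => (K.f j x - K.c) * nodeShare T a x) '' {x | x ∈ K.penalties j ∧ x ≤ K.v} with hA
  have hbdd (a : V) (j : Fin n) : BddAbove (A a j) := by
    refine ⟨K.f j K.v - K.c, ?_⟩
    rintro _ ⟨x, ⟨hx, hxv⟩, rfl⟩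
    have hs := share_pos (μ := fun j => (T j).penalty a) hK (h0 a) (h1 a) x
    have hs1 := share_le_one (μ := fun j => (T j).penalty a) hK (h0 a) (h1 a) x
    have hf := hK.f_le_f_v hx hxv
    have hv := hK.cost_lt_f_v j
    change (K.f j x - K.c) * nodeShare T a x ≤ _
    rcases le_or_gt (K.f j x) K.c with hc | hc
    · exact (mul_nonpos_of_nonpos_of_nonneg (by linarith) hs.le).trans (by linarith)
    · exact (mul_le_of_le_one_right (by linarith) hs1).trans (by linarith)
  -- The value is a supremum because a best penalty need not exist in a state that never offers at
  -- the node.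
  set U : V → Fin n → ℝ := fun a j => sSup (A a j) with hU
  have hle (a : V) (j : Fin n) (x : ℝ) (hx : x ∈ K.penalties j) (hxv : x ≤ K.v) :
      (K.f j x - K.c) * nodeShare T a x ≤ U a j :=
    le_csSup (hbdd a j) ⟨x, ⟨hx, hxv⟩, rfl⟩
  have hUpos (a : V) (j : Fin n) : 0 < U a j :=
    (mul_pos (sub_pos.2 (hK.cost_lt_f_v j)) (share_pos hK (h0 a) (h1 a) _)).trans_le
      (hle a j _ (hK.v_mem j) le_rfl)
  have happrox (a : V) (j : Fin n) (ε : ℝ) (hε : 0 < ε) : ∃ x ∈ K.penalties j, x ≤ K.v ∧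
      U a j - ε < (K.f j x - K.c) * nodeShare T a x := by
    obtain ⟨_, ⟨x, ⟨hx, hxv⟩, rfl⟩, h⟩ := exists_lt_of_lt_csSup
      (show (A a j).Nonempty from ⟨_, K.v, ⟨hK.v_mem j, le_rfl⟩, rfl⟩) (sub_lt_self (U a j) hε)
    exact ⟨x, hx, hxv, h⟩
  have hint (a : V) (j : Fin n) :
      ∫ x, nodePayoff S i j a x ∂((T j).penalty a : Measure ℝ) ≤ U a j := by
    refine integral_nodePayoff_le (T j) (hUpos a j).le fun x hx hxv => ?_
    rw [nodePayoff_eq hT, if_pos hxv]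
    exact hle a j x hx hxv
  set P : Fin n → ℝ := fun j => payoff S i j (T j) with hP
  have hdev (j : Fin n) (J : Finset V) (hJ : G.IsIndepSet (J : Set V)) :
      ∑ a ∈ J, U a j ≤ P j := by
    refine le_of_forall_pos_le_add fun ε hε => ?_
    -- The error is divided among the nodes of `J`; the `+ 1` covers the empty set.
    have hε' : 0 < ε / (J.card + 1) := by positivity
    choose x hx hxv hxU using fun a => happrox a j _ hε'
    have hne := hS.1 i j (pureStrategy j J hJ x hx)
    rw [payoff_pureStrategy, hT] at hne
    have hsum : ∑ a ∈ J, (U a j - ε / (J.card + 1)) ≤ ∑ a ∈ J, nodePayoff S i j a (x a) := by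
      refine Finset.sum_le_sum fun a _ => ?_
      rw [nodePayoff_eq hT, if_pos (hxv a)]
      exact (hxU a).le
    rw [Finset.sum_sub_distrib, Finset.sum_const, nsmul_eq_mul] at hsum
    have hc : (J.card : ℝ) * (ε / (J.card + 1)) ≤ ε := by
      rw [mul_div_assoc', div_le_iff₀ (by positivity)]
      nlinarith
    linarith
  have hopt (j : Fin n) (I : Finset V) (hI : (T j).select I ≠ 0) :
      -- The payoff averages the payoffs of the selected sets, none of which exceeds `P j`, so each
      -- set of positive weight attains it.
      ∑ a ∈ I, ∫ x, nodePayoff S i j a x ∂((T j).penalty a : Measure ℝ) = P j := by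
    have hterm (I : Finset V) : 0 ≤ (T j).select I *
        (P j - ∑ a ∈ I, ∫ x, nodePayoff S i j a x ∂((T j).penalty a : Measure ℝ)) := by
      rcases eq_or_ne ((T j).select I) 0 with h | h
      · simp [h]
      · exact mul_nonneg ((T j).select_nonneg I) (sub_nonneg.2
          ((Finset.sum_le_sum fun a _ => hint a j).trans (hdev j I ((T j).select_indep I h))))
    have hsum : ∑ I, (T j).select I *
        (P j - ∑ a ∈ I, ∫ x, nodePayoff S i j a x ∂((T j).penalty a : Measure ℝ)) = 0 := by
      simp only [mul_sub, Finset.sum_sub_distrib, ← Finset.sum_mul, (T j).select_sum, one_mul]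
      exact sub_self _
    have := (Finset.sum_eq_zero_iff_of_nonneg fun I _ => hterm I).1 hsum I (Finset.mem_univ I)
    exact (sub_eq_zero.1 ((mul_eq_zero.1 this).resolve_left hI)).symm
  have hopt' (j : Fin n) (I : Finset V) (hI : (T j).select I ≠ 0) : ∑ a ∈ I, U a j = P j :=
    le_antisymm (hdev j I ((T j).select_indep I hI))
      ((hopt j I hI).symm.trans_le (Finset.sum_le_sum fun a _ => hint a j))
  have hbest (a : V) (j : Fin n) (ha : 0 < (T j).nodeProb a) :
      ∀ᵐ x ∂((T j).penalty a : Measure ℝ), x ∈ K.penalties j ∧ x ≤ K.v ∧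
        (K.f j x - K.c) * nodeShare T a x = U a j := by
    obtain ⟨I, hI, hI0⟩ := Finset.exists_ne_zero_of_sum_ne_zero ha.ne'
    have haI : a ∈ I := by simpa using hI
    have heq := (Finset.sum_eq_sum_iff_of_le fun a _ => hint a j).1
      ((hopt j I hI0).trans (hopt' j I hI0).symm) a haI
    -- The integral equals `U a j > 0`, so it is not the default value `0` of a nonintegrable
    -- function.
    have hintg : Integrable (fun x => nodePayoff S i j a x) ((T j).penalty a : Measure ℝ) :=
      .of_integral_ne_zero (by rw [heq]; exact (hUpos a j).ne')
    have hae : (fun x => nodePayoff S i j a x) ≤ᵐ[((T j).penalty a : Measure ℝ)]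
        fun _ => U a j := by
      filter_upwards [(T j).penalty_mem a] with x hx
      rw [nodePayoff_eq hT]
      split_ifs with hxv
      · exact hle a j x hx hxv
      · exact (hUpos a j).le
    have := (integral_eq_iff_of_ae_le hintg (integrable_const _) hae).1 (by simpa using heq)
    filter_upwards [(T j).penalty_mem a, this] with x hx hxU
    rw [nodePayoff_eq hT] at hxU
    split_ifs at hxU with hxv
    · exact ⟨hx, hxv, hxU⟩
    · exact absurd hxU (hUpos a j).ne
  have hatom (a : V) := load_singleton_eq_zero hK (h0 a) (h1 a) (hUpos a) (hle a) (hbest a)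
  have hshare (a : V) (x : ℝ) := share_eq_W (hatom a x)
  refine ⟨U, fun a => ⟨h0 a, h1 a, hatom a, fun j x hx hxv => ?_, fun j ε hε => ?_, fun j hj => ?_⟩,
    fun j I hI J hJ => (hdev j J hJ).trans_eq (hopt' j I hI).symm⟩
  · rw [← hshare]; exact hle a j x hx hxv
  · obtain ⟨x, hx, hxv, h⟩ := happrox a j ε hε
    exact ⟨x, hx, hxv, by rw [← hshare]; exact h⟩
  · filter_upwards [hbest a j hj] with x hx
    exact ⟨hx.1, hx.2.1, by rw [← hshare]; exact hx.2.2⟩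

/-- Node equilibria and optimal independent sets give a symmetric equilibrium. -/
theorem isSymmetricNE_const (hK : K.Admissible) (T : K.Strategy G) (U : V → Fin n → ℝ)
    (hU : ∀ a, NodeEq K (fun j => (T j).nodeProb a) (fun j => (T j).penalty a) (U a))
    (B : Fin n → ℝ) (hB : ∀ j, ∀ I : Finset V, G.IsIndepSet (I : Set V) → ∑ a ∈ I, U a j ≤ B j)
    (hT : ∀ j I, (T j).select I ≠ 0 → ∑ a ∈ I, U a j = B j) :
    IsSymmetricNE (fun _ : Fin K.l => T) := by
  refine ⟨fun i j ψ => ?_, fun _ _ => rfl⟩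
  set S : K.Profile G := fun _ => T with hS
  have hST : ∀ k, S k = T := fun _ => rfl
  have hpay (a : V) (x : ℝ) (hxv : x ≤ K.v) : nodePayoff S i j a x = (K.f j x - K.c)
      * K.W (K.load (fun j => (T j).nodeProb a) (fun j => (T j).penalty a) (Set.Iic x)) := by
    rw [nodePayoff_eq hST, if_pos hxv, nodeShare, share_eq_W ((hU a).atom x)]
  have hψ : payoff S i j ψ ≤ B j := by
    calc payoff S i j ψ ≤ ∑ I, ψ.select I * B j := by
          refine Finset.sum_le_sum fun I _ => ?_
          rcases eq_or_ne (ψ.select I) 0 with h | h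
          · simp [h]
          refine mul_le_mul_of_nonneg_left ?_ (ψ.select_nonneg I)
          refine le_trans (Finset.sum_le_sum fun a _ => ?_) (hB j I (ψ.select_indep I h))
          refine integral_nodePayoff_le ψ ((hU a).U_pos hK j).le fun x hx hxv => ?_
          rw [hpay a x hxv]
          exact (hU a).le j x hx hxv
      _ = B j := by rw [← Finset.sum_mul, ψ.select_sum, one_mul]
  refine hψ.trans_eq ?_
  calc B j = ∑ I, (T j).select I * B j := by rw [← Finset.sum_mul, (T j).select_sum, one_mul]
    _ = payoff S i j (T j) := by
      refine Finset.sum_congr rfl fun I _ => ?_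
      rcases eq_or_ne ((T j).select I) 0 with h | h
      · simp [h]
      rw [← hT j I h]
      congr 1
      refine Finset.sum_congr rfl fun a ha => ?_
      have hae : (fun x => nodePayoff S i j a x) =ᵐ[((T j).penalty a : Measure ℝ)]
          fun _ => U a j := by
        filter_upwards [(hU a).best j ((T j).nodeProb_pos h ha)] with x hx
        rw [hpay a x hx.2.1]
        exact hx.2.2
      rw [integral_congr_ae hae]
      simp

end Market
end

/-! ### Selected sets on the path have one parity -/

noncomputable section
namespace Market

variable {n : ℕ} {K : Market n}

lemma tail_congr_of_eq_zero {α : Fin n → ℝ} {i : ℕ} (h : ∀ k : Fin n, (k : ℕ) < i → α k = 0) :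
    K.tail α i = K.tail α 0 := by
  refine Finset.sum_subset (fun k _ => by simp) fun k _ hk => ?_
  rw [Finset.mem_filter_univ, not_le] at hk
  rw [h k hk, mul_zero]

lemma tail_slack (α β : Fin n → ℝ) (i : ℕ) :
    K.tail (fun j => 1 - α j - β j) i = K.tail (fun _ => 1) i - K.tail α i - K.tail β i := by
  simp only [tail, mul_sub, Finset.sum_sub_distrib]

section Swap

variable {V : Type*} [Fintype V] [DecidableEq V] {G : SimpleGraph V}

/-- If `b` is the only possible neighbour of `a` in an optimal independent set `I` without `a`,
then `b` is in `I`, and it is at least as valuable as `a`. -/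
lemma swap_le {u : V → ℝ} (hu : ∀ a, 0 < u a) {I : Finset V} (hI : G.IsIndepSet (I : Set V))
    (hopt : ∀ J : Finset V, G.IsIndepSet (J : Set V) → ∑ a ∈ J, u a ≤ ∑ a ∈ I, u a)
    {a b : V} (ha : a ∉ I) (hb : ∀ c ∈ I, G.Adj a c → c = b) : b ∈ I ∧ u a ≤ u b := by
  have hJ : G.IsIndepSet ((insert a (I.erase b) : Finset V) : Set V) := by
    rw [Finset.coe_insert]
    refine Set.pairwise_insert.2 ⟨Set.Pairwise.mono (by simp) hI, fun c hc _ => ?_⟩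
    have hc' := Finset.mem_erase.1 (Finset.mem_coe.1 hc)
    exact ⟨fun hac => hc'.1 (hb c hc'.2 hac), fun hac => hc'.1 (hb c hc'.2 hac.symm)⟩
  have h1 := hopt _ hJ
  rw [Finset.sum_insert (by simp [ha])] at h1
  by_cases hbI : b ∈ I
  · rw [← Finset.add_sum_erase I u hbI] at h1
    exact ⟨hbI, by linarith⟩
  · rw [Finset.erase_eq_of_notMem hbI] at h1
    linarith [hu a]

/-- The probability that neither `a` nor `b` is selected. -/
lemma StateStrategy.one_sub_nodeProb {j : Fin n} (ψ : K.StateStrategy G j) (a b : V) :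
    1 - ψ.nodeProb a - ψ.nodeProb b
      = ∑ I, ψ.select I * (1 - (if a ∈ I then 1 else 0) - if b ∈ I then 1 else 0) := by
  simp only [mul_sub, Finset.sum_sub_distrib, mul_one, ψ.select_sum, mul_ite, mul_zero,
    ← Finset.sum_filter]
  rfl

lemma StateStrategy.slack_term_nonneg {j : Fin n} (ψ : K.StateStrategy G j) {a b : V}
    (hab : G.Adj a b) (I : Finset V) :
    0 ≤ ψ.select I * (1 - (if a ∈ I then 1 else 0) - if b ∈ I then 1 else 0) := by
  rcases eq_or_ne (ψ.select I) 0 with h | h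
  · simp [h]
  refine mul_nonneg (ψ.select_nonneg I) ?_
  have : ¬ (a ∈ I ∧ b ∈ I) := fun ⟨ha, hb⟩ => ψ.select_indep I h ha hb hab.ne hab
  split_ifs with ha hb
  · exact absurd ⟨ha, hb⟩ this
  all_goals norm_num

lemma StateStrategy.slack_nonneg {j : Fin n} (ψ : K.StateStrategy G j) {a b : V}
    (hab : G.Adj a b) : 0 ≤ 1 - ψ.nodeProb a - ψ.nodeProb b := by
  rw [ψ.one_sub_nodeProb]
  exact Finset.sum_nonneg fun I _ => ψ.slack_term_nonneg hab I

/-- An independent set contains at most one end of an edge, so the slack is exactly the probability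
of missing the edge. -/
lemma StateStrategy.slack_pos_iff {j : Fin n} (ψ : K.StateStrategy G j) {a b : V}
    (hab : G.Adj a b) : 0 < 1 - ψ.nodeProb a - ψ.nodeProb b
      ↔ ∃ I, ψ.select I ≠ 0 ∧ a ∉ I ∧ b ∉ I := by
  rw [(ψ.slack_nonneg hab).lt_iff_ne', ψ.one_sub_nodeProb, ne_eq,
    Finset.sum_eq_zero_iff_of_nonneg fun I _ => ψ.slack_term_nonneg hab I]
  constructor
  · intro h
    push Not at h
    obtain ⟨I, -, hI⟩ := h
    refine ⟨I, left_ne_zero_of_mul hI, ?_⟩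
    have h1 := right_ne_zero_of_mul hI
    have h2 : ¬ (a ∈ I ∧ b ∈ I) := fun ⟨ha, hb⟩ =>
      ψ.select_indep I (left_ne_zero_of_mul hI) ha hb hab.ne hab
    by_cases ha : a ∈ I <;> by_cases hb : b ∈ I <;> simp_all
  · rintro ⟨I, hI, ha, hb⟩ h
    have := h I (Finset.mem_univ I)
    simp [ha, hb, hI] at this

end Swap

section Path

variable {M : ℕ}

/-- In an equilibrium on a path every selected independent set meets every edge. -/
lemma mem_or_mem_of_select_ne_zero (hK : K.Admissible) {T : K.Strategy (SimpleGraph.pathGraph M)}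
    {U : Fin M → Fin n → ℝ}
    (hU : ∀ a, NodeEq K (fun j => (T j).nodeProb a) (fun j => (T j).penalty a) (U a))
    (hopt : ∀ j I, (T j).select I ≠ 0 → ∀ J : Finset (Fin M),
      (SimpleGraph.pathGraph M).IsIndepSet (J : Set (Fin M)) → ∑ a ∈ J, U a j ≤ ∑ a ∈ I, U a j)
    (j : Fin n) (I : Finset (Fin M)) (hI : (T j).select I ≠ 0) (a b : Fin M)
    (hab : (a : ℕ) + 1 = b) : a ∈ I ∨ b ∈ I := by
  classical
  by_contra! hnot
  -- Indexing by `ℕ`, with the default `0` off the path, allows arithmetic on nodes.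
  set α : ℕ → Fin n → ℝ := fun k j => if h : k < M then (T j).nodeProb ⟨k, h⟩ else 0 with hα
  have hαa (a : Fin M) : α a = fun j => (T j).nodeProb a := by
    funext j; simp [hα]
  set σ : ℕ → Fin n → ℝ := fun k j => 1 - α k j - α (k + 1) j with hσ
  have hadj (k : ℕ) (hk : k + 1 < M) :
      (SimpleGraph.pathGraph M).Adj ⟨k, Nat.lt_of_succ_lt hk⟩ ⟨k + 1, hk⟩ :=
    SimpleGraph.pathGraph_adj.2 (Or.inl rfl)
  have hσe (k : ℕ) (hk : k + 1 < M) (j : Fin n) : σ k j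
      = 1 - (T j).nodeProb ⟨k, Nat.lt_of_succ_lt hk⟩ - (T j).nodeProb ⟨k + 1, hk⟩ := by
    simp [hσ, hα, hk, Nat.lt_of_succ_lt hk]
  have hσ0 (k : ℕ) (hk : k + 1 < M) (j : Fin n) : 0 ≤ σ k j := by
    rw [hσe k hk]; exact (T j).slack_nonneg (hadj k hk)
  set τ : ℕ → ℕ → ℝ := fun k => K.tail (σ k) with hτ
  have hτe (k i : ℕ) : τ k i = K.tail (fun _ => 1) i - K.tail (α k) i - K.tail (α (k + 1)) i :=
    tail_slack _ _ i
  have hτanti (k : ℕ) (hk : k + 1 < M) : Antitone (τ k) := tail_antitone hK (hσ0 k hk)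
  have hpos : 0 < τ a 0 := by
    have haM : (a : ℕ) + 1 < M := by have := b.2; omega
    refine Finset.sum_pos' (fun k _ => mul_nonneg (hK.q_pos k).le (hσ0 a haM k))
      ⟨j, by simp, mul_pos (hK.q_pos j) ?_⟩
    rw [hσe a haM]
    refine ((T j).slack_pos_iff (hadj a haM)).2 ⟨I, hI, hnot.1, ?_⟩
    have : (⟨(a : ℕ) + 1, haM⟩ : Fin M) = b := Fin.ext hab
    rw [this]; exact hnot.2
  obtain ⟨m, hm, hmax⟩ := Finset.exists_max_image (Finset.range (M - 1)) (fun k => τ k 0)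
    ⟨a, by have := b.2; simp; omega⟩
  have hex : ∃ k, k + 1 < M ∧ τ k 0 = τ m 0 :=
    ⟨m, by have := Finset.mem_range.1 hm; omega, rfl⟩
  -- The leftmost edge of maximal total slack: edges to its left have strictly less slack, the
  -- others at most as much.
  set k := Nat.find hex with hk
  obtain ⟨hkM, hkm⟩ := Nat.find_spec hex
  rw [← hk] at hkM hkm
  have hle (k' : ℕ) (hk' : k' + 1 < M) : τ k' 0 ≤ τ k 0 := by
    rw [hkm]; exact hmax k' (by simp; omega)
  have hlt (k' : ℕ) (hk' : k' < k) : τ k' 0 < τ k 0 := by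
    refine (hle k' (by omega)).lt_of_ne fun h => Nat.find_min hex hk' ⟨by omega, h.trans hkm⟩
  have hkpos : 0 < τ k 0 := hpos.trans_le (hle a (by have := b.2; omega))
  have hslack : {j | 0 < σ k j}.Nonempty := by
    by_contra hcon
    refine hkpos.ne' (Finset.sum_eq_zero fun j _ => ?_)
    have : ¬ 0 < σ k j := fun h => hcon ⟨j, h⟩
    rw [le_antisymm (not_lt.1 this) (hσ0 k hkM j), mul_zero]
  -- In the worst state with slack on this edge, all tails of the slack up to `i` still equal the
  -- total, so they dominate the corresponding tails on neighbouring edges.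
  obtain ⟨i, hi, himin⟩ := WellFounded.has_min (wellFounded_lt (α := Fin n)) _ hslack
  have hconst (i' : ℕ) (hi' : i' ≤ i) : τ k i' = τ k 0 := by
    refine tail_congr_of_eq_zero fun l hl => ?_
    exact le_antisymm (not_lt.1 fun h => himin l h (Fin.lt_def.2 (by omega))) (hσ0 k hkM l)
  change 0 < σ k i at hi
  rw [hσe k hkM, (T i).slack_pos_iff (hadj k hkM)] at hi
  obtain ⟨J, hJ, hJ1, hJ2⟩ := hi
  have hswap {a b : Fin M} := swap_le (u := fun a => U a i) (fun a => (hU a).U_pos hK i)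
    ((T i).select_indep J hJ) (hopt i J hJ) (a := a) (b := b)
  have hadj_iff (a b : Fin M) : (SimpleGraph.pathGraph M).Adj a b ↔
    (a : ℕ) + 1 = b ∨ (b : ℕ) + 1 = a := SimpleGraph.pathGraph_adj
  -- The edge cannot be at an end of the path: an end node without neighbours in `J` could be added
  -- to `J`.
  obtain ⟨k₀, hk₀⟩ : ∃ k₀, k = k₀ + 1 := by
    refine Nat.exists_eq_succ_of_ne_zero fun h0 => hJ2 (hswap hJ1 fun c _ hc => ?_).1
    rw [hadj_iff] at hc
    refine Fin.ext ?_
    simp only at hc ⊢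
    omega
  have hkM2 : k + 2 < M := by
    by_contra hcon
    refine hJ1 (hswap hJ2 fun c _ hc => ?_).1
    rw [hadj_iff] at hc
    refine Fin.ext ?_
    have := c.2
    simp only at hc ⊢
    omega
  have hU1 : U ⟨k, Nat.lt_of_succ_lt hkM⟩ i ≤ U ⟨k₀, by omega⟩ i := by
    refine (hswap hJ1 fun c hcJ hc => ?_).2
    rw [hadj_iff] at hc
    have : (c : ℕ) ≠ k + 1 := fun h => hJ2 (by convert hcJ; exact h.symm)
    refine Fin.ext ?_
    simp only at hc ⊢
    omega
  have hU2 : U ⟨k + 1, hkM⟩ i ≤ U ⟨k + 2, hkM2⟩ i := by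
    refine (hswap hJ2 fun c hcJ hc => ?_).2
    rw [hadj_iff] at hc
    have : (c : ℕ) ≠ k := fun h => hJ1 (by convert hcJ; exact h.symm)
    refine Fin.ext ?_
    simp only at hc ⊢
    omega
  have hload (a : Fin M) : IsLoad (K.tail (α a)) := by
    rw [hαa]; exact isLoad_tail hK (hU a).nonneg (hU a).le_one
  have hval (a : Fin M) : U a = K.value (K.tail (α a)) := by
    rw [hαa]; exact (hU a).U_eq_value hK
  -- Adjacent edges share node `k`, whose tail cancels in the comparison of their slacks.
  have hlt1 (i' : ℕ) (hi' : i' ≤ i) : K.tail (α (k + 1)) i' < K.tail (α k₀) i' := by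
    have h1 := hτe k i'
    have h2 := hτe k₀ i'
    rw [← hk₀] at h2
    have h3 := hlt k₀ (by omega)
    have h4 := hτanti k₀ (by omega) (Nat.zero_le i')
    rw [hconst i' hi'] at h1
    linarith
  have hle2 (i' : ℕ) (hi' : i' ≤ i) : K.tail (α k) i' ≤ K.tail (α (k + 2)) i' := by
    have h1 := hτe k i'
    have h2 := hτe (k + 1) i'
    have h3 := hle (k + 1) (by omega)
    have h4 := hτanti (k + 1) (by omega) (Nat.zero_le i')
    rw [hconst i' hi'] at h1
    linarith
  have hV1 : U ⟨k₀, by omega⟩ i < U ⟨k + 1, hkM⟩ i := by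
    rw [hval, hval]
    exact (IsLoad.value_le hK (hload ⟨k₀, by omega⟩) (hload ⟨k + 1, hkM⟩) i
      fun i' hi' => (hlt1 i' hi').le).2 (hlt1 i le_rfl)
  have hV2 : U ⟨k + 2, hkM2⟩ i ≤ U ⟨k, Nat.lt_of_succ_lt hkM⟩ i := by
    rw [hval, hval]
    exact (IsLoad.value_le hK (hload ⟨k + 2, hkM2⟩) (hload ⟨k, Nat.lt_of_succ_lt hkM⟩) i hle2).1
  -- The cycle is `U k ≤ U k₀ < U (k + 1) ≤ U (k + 2) ≤ U k` in state `i`.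
  linarith

/-- An independent set that meets every edge of the path consists of the nodes of one parity. -/
lemma eq_oddNodes_or_eq_evenNodes {I : Finset (Fin M)}
    (hI : (SimpleGraph.pathGraph M).IsIndepSet (I : Set (Fin M)))
    (h : ∀ a b : Fin M, (a : ℕ) + 1 = b → a ∈ I ∨ b ∈ I) : I = oddNodes M ∨ I = evenNodes M := by
  have hflip (a b : Fin M) (hab : (a : ℕ) + 1 = b) : b ∈ I ↔ a ∉ I := by
    constructor
    · intro hb ha
      have hadj : (SimpleGraph.pathGraph M).Adj a b := SimpleGraph.pathGraph_adj.2 (Or.inl hab)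
      exact hI ha hb hadj.ne hadj
    · intro ha
      exact (h a b hab).resolve_left ha
  by_cases h0 : ∃ hM : 0 < M, (⟨0, hM⟩ : Fin M) ∈ I
  · left
    obtain ⟨hM, h0⟩ := h0
    have key (k : ℕ) (hk : k < M) : (⟨k, hk⟩ : Fin M) ∈ I ↔ Odd (k + 1) := by
      induction k with
      | zero => simpa using h0
      | succ k ih =>
        rw [hflip ⟨k, by omega⟩ ⟨k + 1, hk⟩ rfl, ih (by omega)]
        grind
    ext a
    rw [oddNodes, Finset.mem_filter_univ]
    exact key a a.2
  · right
    push Not at h0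
    have key (k : ℕ) (hk : k < M) : (⟨k, hk⟩ : Fin M) ∈ I ↔ Even (k + 1) := by
      induction k with
      | zero => simpa using h0 hk
      | succ k ih =>
        rw [hflip ⟨k, by omega⟩ ⟨k + 1, hk⟩ rfl, ih (by omega)]
        grind
    ext a
    rw [evenNodes, Finset.mem_filter_univ]
    exact key a a.2

end Path

end Market
end

/-! ### Balancing the two classes of nodes -/

noncomputable section

/-- A continuous decreasing function on `[0, b]` has a root, or it has a sign and the root is
replaced by an endpoint. -/
lemma exists_root_or_endpoint {C : ℝ → ℝ} {b : ℝ} (hb : 0 ≤ b)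
    (hc : ContinuousOn C (Set.Icc 0 b)) (ha : AntitoneOn C (Set.Icc 0 b)) :
    ∃ y ∈ Set.Icc 0 b, (∀ r ∈ Set.Icc 0 b, (r < y → 0 ≤ C r) ∧ (y < r → C r ≤ 0)) ∧
      (0 < y → 0 ≤ C y) ∧ (y < b → C y ≤ 0) := by
  have h0 : (0 : ℝ) ∈ Set.Icc 0 b := ⟨le_rfl, hb⟩
  have hb' : b ∈ Set.Icc 0 b := ⟨hb, le_rfl⟩
  rcases le_total (C 0) 0 with h | h
  · exact ⟨0, h0, fun r hr => ⟨fun hlt => absurd hr.1 (not_le.2 hlt),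
      fun _ => (ha h0 hr hr.1).trans h⟩, fun hlt => absurd hlt (lt_irrefl _), fun _ => h⟩
  rcases le_total 0 (C b) with h' | h'
  · exact ⟨b, hb', fun r hr => ⟨fun _ => h'.trans (ha hr hb' hr.2),
      fun hlt => absurd hr.2 (not_le.2 hlt)⟩, fun _ => h', fun hlt => absurd hlt (lt_irrefl _)⟩
  obtain ⟨y, hy, hy0⟩ := intermediate_value_Icc' hb hc (show (0 : ℝ) ∈ _ from ⟨h', h⟩)
  exact ⟨y, hy, fun r hr => ⟨fun hlt => hy0.ge.trans (ha hr hy hlt.le),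
    fun hlt => (ha hy hr hlt.le).trans hy0.le⟩, fun _ => hy0.ge, fun _ => hy0.le⟩

namespace Market

variable {n : ℕ} {K : Market n}

/-- The total payoff of `k₁` nodes with loads `s` minus that of `k₂` nodes with the complementary
loads. -/
def advantage (K : Market n) (k₁ k₂ : ℕ) (s : ℕ → ℝ) (j : Fin n) : ℝ :=
  k₁ * K.value s j - k₂ * K.value (fun i => K.tail (fun _ => 1) i - s i) j

/-- Loads `s` whose complementary loads are loads as well. -/
structure IsSplit (K : Market n) (s : ℕ → ℝ) : Prop where
  diff_nonneg : ∀ j : Fin n, 0 ≤ s j - s (j + 1)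
  diff_le : ∀ j : Fin n, s j - s (j + 1) ≤ K.q j
  eq_zero : ∀ i, n ≤ i → s i = 0

namespace IsSplit

variable {s s' : ℕ → ℝ}

lemma compl (hs : IsSplit K s) : IsSplit K (fun i => K.tail (fun _ => 1) i - s i) := by
  refine ⟨fun j => ?_, fun j => ?_, fun i hi => ?_⟩
  · have := hs.diff_le j
    simp only [tail_succ_add j]
    linarith
  · have := hs.diff_nonneg j
    simp only [tail_succ_add j]
    linarith
  · simp only [tail_of_le hi, hs.eq_zero i hi, sub_zero]

lemma antitone (hs : IsSplit K s) : Antitone s := by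
  refine antitone_nat_of_succ_le fun i => ?_
  by_cases hi : i < n
  · exact sub_nonneg.1 (hs.diff_nonneg ⟨i, hi⟩)
  · rw [hs.eq_zero i (by omega), hs.eq_zero (i + 1) (by omega)]

lemma nonneg (hs : IsSplit K s) (i : ℕ) : 0 ≤ s i :=
  (hs.eq_zero _ (le_max_right i n)).ge.trans (hs.antitone (le_max_left i n))

lemma isLoad (hK : K.Admissible) (hs : IsSplit K s) : IsLoad s := by
  refine ⟨hs.nonneg, hs.antitone, ?_⟩
  have h1 := hs.compl.nonneg 0
  have h2 := tail_zero_lt_one hK (α := fun _ => 1) fun _ => le_rfl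
  linarith

/-- Raising the load of one class lowers that of the other, so both terms move the advantage the
same way. -/
lemma advantage_le (hK : K.Admissible) (hs : IsSplit K s) (hs' : IsSplit K s') (k₁ k₂ : ℕ)
    (j : Fin n) (h : ∀ i : ℕ, i ≤ j → s' i ≤ s i) :
    K.advantage k₁ k₂ s j ≤ K.advantage k₁ k₂ s' j := by
  have h1 := (IsLoad.value_le hK (hs.isLoad hK) (hs'.isLoad hK) j h).1
  have h2 := (IsLoad.value_le hK (hs'.compl.isLoad hK) (hs.compl.isLoad hK) j
    fun i hi => sub_le_sub_left (h i hi) _).1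
  exact sub_le_sub (mul_le_mul_of_nonneg_left h1 (Nat.cast_nonneg _))
    (mul_le_mul_of_nonneg_left h2 (Nat.cast_nonneg _))

/-- The strictness comes from the first class alone; the second may be empty, as on a path with one
node. -/
lemma advantage_lt (hK : K.Admissible) (hs : IsSplit K s) (hs' : IsSplit K s') {k₁ : ℕ}
    (hk₁ : 0 < k₁) (k₂ : ℕ) (j : Fin n) (h : ∀ i : ℕ, i ≤ j → s' i ≤ s i) (hj : s' j < s j) :
    K.advantage k₁ k₂ s j < K.advantage k₁ k₂ s' j := by
  have h1 := (IsLoad.value_le hK (hs.isLoad hK) (hs'.isLoad hK) j h).2 hj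
  have h2 := (IsLoad.value_le hK (hs'.compl.isLoad hK) (hs.compl.isLoad hK) j
    fun i hi => sub_le_sub_left (h i hi) _).1
  have h3 := mul_lt_mul_of_pos_left h1 (Nat.cast_pos (α := ℝ).2 hk₁)
  have h4 := mul_le_mul_of_nonneg_left h2 (Nat.cast_nonneg (α := ℝ) k₂)
  exact (sub_lt_sub_right h3 _).trans_le (sub_le_sub_left h4 _)

lemma advantage_congr (hK : K.Admissible) (hs : IsSplit K s) (hs' : IsSplit K s') (k₁ k₂ : ℕ)
    (j : Fin n) (h : ∀ i : ℕ, i ≤ j → s i = s' i) :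
    K.advantage k₁ k₂ s j = K.advantage k₁ k₂ s' j :=
  le_antisymm (hs.advantage_le hK hs' k₁ k₂ j fun i hi => (h i hi).ge)
    (hs'.advantage_le hK hs k₁ k₂ j fun i hi => (h i hi).le)

end IsSplit

/-- The condition on the load of state `j` in an equilibrium in which the two classes of nodes are
the alternatives. -/
def IsBalanced (K : Market n) (k₁ k₂ : ℕ) (s : ℕ → ℝ) (j : Fin n) : Prop :=
  (0 < s j - s (j + 1) → 0 ≤ K.advantage k₁ k₂ s j) ∧
    (s j - s (j + 1) < K.q j → K.advantage k₁ k₂ s j ≤ 0)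

lemma min_tail_diff (hK : K.Admissible) (r : ℝ) (j : Fin n) :
    0 ≤ min r (K.tail (fun _ => 1) j) - min r (K.tail (fun _ => 1) (j + 1)) ∧
    min r (K.tail (fun _ => 1) j) - min r (K.tail (fun _ => 1) (j + 1)) ≤ K.q j := by
  have hq := hK.q_pos j
  rw [tail_succ_add j, mul_one]
  constructor
  · exact sub_nonneg.2 (min_le_min_left _ (by linarith))
  · rcases le_total r (K.tail (fun _ => 1) (j + 1)) with h | h
    · rw [min_eq_left h]
      linarith [min_le_left r (K.q j + K.tail (fun _ => 1) (j + 1))]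
    · rw [min_eq_right h]
      linarith [min_le_right r (K.q j + K.tail (fun _ => 1) (j + 1))]

/-- Given the load of the states `j, j + 1, …`, the loads of the worse states can be balanced, in a
continuous and monotone way. -/
lemma exists_balanced_family (hK : K.Admissible) (k₁ k₂ : ℕ) (j : ℕ) (hj : j ≤ n) :
    ∃ s : ℝ → ℕ → ℝ, (∀ i, ContinuousOn (fun r => s r i) (Set.Icc 0 (K.tail (fun _ => 1) j))) ∧
      (∀ i, MonotoneOn (fun r => s r i) (Set.Icc 0 (K.tail (fun _ => 1) j))) ∧
      ∀ r ∈ Set.Icc 0 (K.tail (fun _ => 1) j), IsSplit K (s r) ∧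
        (∀ i, j ≤ i → s r i = min r (K.tail (fun _ => 1) i)) ∧
        ∀ i : Fin n, i < j → IsBalanced K k₁ k₂ (s r) i := by
  induction j with
  | zero =>
    refine ⟨fun r i => min r (K.tail (fun _ => 1) i), fun i => by fun_prop,
      fun i r _ r' _ h => min_le_min_right _ h, fun r hr => ⟨⟨fun j => (min_tail_diff hK r j).1,
        fun j => (min_tail_diff hK r j).2, fun i hi => ?_⟩, fun _ _ => rfl,
        fun i hi => absurd hi (by omega)⟩⟩
    change min r (K.tail (fun _ => 1) i) = 0
    rw [tail_of_le hi, min_eq_right hr.1]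
  | succ j ih =>
    obtain ⟨s, hcont, hmono, hs⟩ := ih (by omega)
    set J : Fin n := ⟨j, hj⟩ with hJ
    set b := K.tail (fun _ => 1) j with hb
    have hq := hK.q_pos J
    have hbs : b = K.q J + K.tail (fun _ => 1) (j + 1) := by
      have := tail_succ_add (K := K) (α := fun _ => 1) J
      rwa [mul_one] at this
    have hb0 : 0 ≤ b := tail_nonneg hK (fun _ => zero_le_one) j
    set C : ℝ → ℝ := fun r => K.advantage k₁ k₂ (s r) J with hC
    have hCc : ContinuousOn C (Set.Icc 0 b) := by
      refine ContinuousOn.sub (continuousOn_const.mul ?_) (continuousOn_const.mul ?_)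
      · exact IsLoad.continuousOn_value hK (fun r hr => (hs r hr).1.isLoad hK) hcont J
      · exact IsLoad.continuousOn_value hK (fun r hr => (hs r hr).1.compl.isLoad hK)
          (fun i => continuousOn_const.sub (hcont i)) J
    have hCa : AntitoneOn C (Set.Icc 0 b) := fun r hr r' hr' h =>
      (hs r' hr').1.advantage_le hK (hs r hr).1 k₁ k₂ J fun i _ => hmono i hr hr' h
    obtain ⟨y, hy, hyr, hy0, hyb⟩ := exists_root_or_endpoint hb0 hCc hCa
    -- Given load `r` of the states after `j`, the load from `j` on can range over `[r, r + q j]`.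
    -- The best choice is the root `y` of the advantage clamped to this interval, which is
    -- continuous and monotone in `r`.
    set φ : ℝ → ℝ := fun r => max r (min y (r + K.q J)) with hφ
    have hφc : Continuous φ := by fun_prop
    have hφm : Monotone φ := fun r r' h =>
      max_le_max h (min_le_min_left _ (by linarith))
    have hφ1 (r : ℝ) : r ≤ φ r := le_max_left _ _
    have hφ2 (r : ℝ) : φ r ≤ r + K.q J := max_le (by linarith) (min_le_right _ _)
    have hφmem (r : ℝ) (hr : r ∈ Set.Icc 0 (K.tail (fun _ => 1) (j + 1))) :
        φ r ∈ Set.Icc 0 b :=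
      ⟨hr.1.trans (hφ1 r), (hφ2 r).trans (by linarith [hr.2])⟩
    -- Up to index `j` the previous family is reused at parameter `φ r`. This preserves balance in
    -- the worse states, whose advantages depend only on those indices.
    set s' : ℝ → ℕ → ℝ := fun r i => if i ≤ j then s (φ r) i else min r (K.tail (fun _ => 1) i)
      with hs'
    have hs'1 (r : ℝ) {i : ℕ} (hi : i ≤ j) : s' r i = s (φ r) i := if_pos hi
    have hs'2 (r : ℝ) {i : ℕ} (hi : j + 1 ≤ i) : s' r i = min r (K.tail (fun _ => 1) i) :=
      if_neg (by omega)
    have hφs (r : ℝ) (hr : r ∈ Set.Icc 0 (K.tail (fun _ => 1) (j + 1))) :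
        s' r j = φ r := by
      rw [hs'1 r le_rfl, (hs _ (hφmem r hr)).2.1 j le_rfl, min_eq_left (hφmem r hr).2]
    have hrs (r : ℝ) (hr : r ∈ Set.Icc 0 (K.tail (fun _ => 1) (j + 1))) :
        s' r (j + 1) = r := by
      rw [hs'2 r le_rfl, min_eq_left hr.2]
    have hsplit (r : ℝ) (hr : r ∈ Set.Icc 0 (K.tail (fun _ => 1) (j + 1))) :
        IsSplit K (s' r) := by
      have hdiff (i : Fin n) : 0 ≤ s' r i - s' r (i + 1) ∧ s' r i - s' r (i + 1) ≤ K.q i := by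
        have h := (hs _ (hφmem r hr)).1
        rcases lt_trichotomy (i : ℕ) j with hi | hi | hi
        · rw [hs'1 r hi.le, hs'1 r (Nat.succ_le_of_lt hi)]
          exact ⟨h.diff_nonneg i, h.diff_le i⟩
        · have : i = J := Fin.ext hi
          subst this
          change 0 ≤ s' r j - s' r (j + 1) ∧ s' r j - s' r (j + 1) ≤ _
          rw [hφs r hr, hrs r hr]
          exact ⟨sub_nonneg.2 (hφ1 r), by linarith [hφ2 r]⟩
        · rw [hs'2 r hi, hs'2 r (Nat.le_succ_of_le hi)]
          exact min_tail_diff hK r i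
      refine ⟨fun i => (hdiff i).1, fun i => (hdiff i).2, fun i hi => ?_⟩
      rw [hs'2 r (by omega), tail_of_le hi, min_eq_right hr.1]
    refine ⟨s', fun i => ?_, fun i => ?_, fun r hr => ⟨hsplit r hr, fun i hi => hs'2 r hi, ?_⟩⟩
    · by_cases hi : i ≤ j
      · simp only [hs'1 _ hi]
        exact (hcont i).comp hφc.continuousOn hφmem
      · simp only [hs'2 _ (not_le.1 hi)]
        fun_prop
    · intro r hr r' hr' h
      by_cases hi : i ≤ j
      · simp only [hs'1 _ hi]
        exact hmono i (hφmem r hr) (hφmem r' hr') (hφm h)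
      · simp only [hs'2 _ (not_le.1 hi)]
        exact min_le_min_right _ h
    · intro i hi
      obtain ⟨h1, -, h3⟩ := hs _ (hφmem r hr)
      have hadv : K.advantage k₁ k₂ (s' r) i = K.advantage k₁ k₂ (s (φ r)) i :=
        (hsplit r hr).advantage_congr hK h1 k₁ k₂ i fun l hl => hs'1 r (by omega)
      rcases (Nat.lt_succ_iff.1 hi).lt_or_eq with hi | hi
      · rw [IsBalanced, hadv, hs'1 r hi.le, hs'1 r (Nat.succ_le_of_lt hi)]
        exact h3 i hi
      · have : i = J := Fin.ext hi
        subst this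
        rw [IsBalanced, hadv]
        change (0 < s' r j - s' r (j + 1) → 0 ≤ C (φ r)) ∧
          (s' r j - s' r (j + 1) < K.q J → C (φ r) ≤ 0)
        rw [hφs r hr, hrs r hr]
        constructor
        · intro h
          have hle : φ r ≤ y := by
            by_contra! hlt
            have : φ r ≤ r := max_le le_rfl (by
              by_contra! h'
              have : φ r = min y (r + K.q J) := max_eq_right h'.le
              exact absurd (this.trans_le (min_le_left _ _)) (not_le.2 hlt))
            linarith
          rcases hle.lt_or_eq with hlt | heq
          · exact (hyr _ (hφmem r hr)).1 hlt
          · rw [heq]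
            exact hy0 (by rw [← heq]; linarith [hr.1])
        · intro h
          have hle : y ≤ φ r := by
            by_contra! hlt
            have : r + K.q J ≤ φ r := by
              refine le_max_of_le_right (le_min ?_ le_rfl)
              by_contra! h'
              have : y ≤ φ r := le_max_of_le_right (le_min le_rfl h'.le)
              linarith
            linarith
          rcases hle.lt_or_eq with hlt | heq
          · exact (hyr _ (hφmem r hr)).2 hlt
          · rw [← heq]
            exact hyb (by rw [heq]; linarith [hr.2])

lemma isSplit_tail (hK : K.Admissible) {t : Fin n → ℝ} (h0 : ∀ j, 0 ≤ t j) (h1 : ∀ j, t j ≤ 1) :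
    IsSplit K (K.tail t) := by
  refine ⟨fun j => ?_, fun j => ?_, fun i hi => tail_of_le hi⟩
  · rw [tail_succ_add j, add_sub_cancel_right]
    exact mul_nonneg (hK.q_pos j).le (h0 j)
  · rw [tail_succ_add j, add_sub_cancel_right]
    exact mul_le_of_le_one_right (hK.q_pos j).le (h1 j)

lemma tail_one_sub (t : Fin n → ℝ) :
    K.tail (fun j => 1 - t j) = fun i => K.tail (fun _ => 1) i - K.tail t i := by
  funext i
  simp only [tail, mul_sub, Finset.sum_sub_distrib]

/-- There are balanced probabilities of selecting the first of two classes of nodes. -/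
theorem exists_balanced (hK : K.Admissible) (k₁ k₂ : ℕ) :
    ∃ t : Fin n → ℝ, (∀ j, 0 ≤ t j) ∧ (∀ j, t j ≤ 1) ∧
      ∀ j, (0 < t j → 0 ≤ K.advantage k₁ k₂ (K.tail t) j) ∧
        (t j < 1 → K.advantage k₁ k₂ (K.tail t) j ≤ 0) := by
  obtain ⟨s, -, -, hs⟩ := exists_balanced_family hK k₁ k₂ n le_rfl
  -- At level `n` no load remains, so `0` is the only parameter and every state is balanced.
  obtain ⟨h1, -, h3⟩ := hs 0 ⟨le_rfl, tail_nonneg hK (fun _ => zero_le_one) n⟩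
  have hqt (j : Fin n) : K.q j * ((s 0 j - s 0 (j + 1)) / K.q j) = s 0 j - s 0 (j + 1) :=
    mul_div_cancel₀ _ (hK.q_pos j).ne'
  set t : Fin n → ℝ := fun j => (s 0 j - s 0 (j + 1)) / K.q j with ht
  have htail : K.tail t = s 0 := by
    funext i
    by_cases hi : n ≤ i
    · rw [tail_of_le hi, h1.eq_zero i hi]
    · induction (not_le.1 hi).le using Nat.decreasingInduction with
      | self => exact absurd le_rfl hi
      | of_succ k hk ih =>
        have h := tail_succ_add (K := K) (α := t) ⟨k, hk⟩
        simp only at h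
        have h' := hqt ⟨k, hk⟩
        simp only at h'
        rw [h, h']
        by_cases hk' : n ≤ k + 1
        · rw [tail_of_le hk', h1.eq_zero _ hk']; ring
        · rw [ih hk']; ring
  refine ⟨t, fun j => div_nonneg (h1.diff_nonneg j) (hK.q_pos j).le,
    fun j => (div_le_one (hK.q_pos j)).2 (h1.diff_le j), fun j => ?_⟩
  rw [htail]
  refine ⟨fun h => (h3 j j.2).1 ?_, fun h => (h3 j j.2).2 ?_⟩
  · rw [← hqt j]; exact mul_pos (hK.q_pos j) h
  · exact (div_lt_one (hK.q_pos j)).1 h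

/-- The balanced probabilities are unique. -/
theorem balanced_unique (hK : K.Admissible) {k₁ k₂ : ℕ} (hk₁ : 0 < k₁) {t t' : Fin n → ℝ}
    (h0 : ∀ j, 0 ≤ t j) (h1 : ∀ j, t j ≤ 1) (h0' : ∀ j, 0 ≤ t' j) (h1' : ∀ j, t' j ≤ 1)
    (h : ∀ j, (0 < t j → 0 ≤ K.advantage k₁ k₂ (K.tail t) j) ∧
      (t j < 1 → K.advantage k₁ k₂ (K.tail t) j ≤ 0))
    (h' : ∀ j, (0 < t' j → 0 ≤ K.advantage k₁ k₂ (K.tail t') j) ∧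
      (t' j < 1 → K.advantage k₁ k₂ (K.tail t') j ≤ 0)) : t = t' := by
  have key (t t' : Fin n → ℝ)
      (h0 : ∀ j, 0 ≤ t j) (h1 : ∀ j, t j ≤ 1) (h0' : ∀ j, 0 ≤ t' j) (h1' : ∀ j, t' j ≤ 1)
      (h : ∀ j, (0 < t j → 0 ≤ K.advantage k₁ k₂ (K.tail t) j))
      (h' : ∀ j, (t' j < 1 → K.advantage k₁ k₂ (K.tail t') j ≤ 0)) (i : ℕ)
      (heq : ∀ k < i, K.tail t k = K.tail t' k) : ¬ K.tail t' i < K.tail t i := by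
    intro hlt
    -- A first difference of tails persists: the larger tail gives the strictly smaller advantage,
    -- so balance forbids `t k > t' k`, and removing state `k` keeps the tail of `t` larger. At
    -- index `n` both tails vanish, which is absurd.
    have hall (k : ℕ) (hk : i ≤ k) : K.tail t' k < K.tail t k := by
      induction k using Nat.strong_induction_on with
      | _ k ih =>
        rcases hk.eq_or_lt with rfl | hk
        · exact hlt
        obtain ⟨k, rfl⟩ : ∃ k', k = k' + 1 := ⟨k - 1, by omega⟩
        have hik : i ≤ k := by omega
        have hkt := ih k (by omega) hik
        by_cases hkn : n ≤ k
        · rw [tail_of_le hkn, tail_of_le hkn] at hkt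
          exact absurd hkt (lt_irrefl _)
        have hlt' := (isSplit_tail hK h0 h1).advantage_lt hK (isSplit_tail hK h0' h1') hk₁ k₂
          ⟨k, not_le.1 hkn⟩ (fun l hl => by
            rcases lt_or_ge l i with hli | hli
            · exact (heq l hli).ge
            · exact (ih l (Nat.lt_succ_of_le hl) hli).le) hkt
        have htt : t ⟨k, not_le.1 hkn⟩ ≤ t' ⟨k, not_le.1 hkn⟩ := by
          by_contra! hcon
          have e1 := h ⟨k, not_le.1 hkn⟩ ((h0' _).trans_lt hcon)
          have e2 := h' ⟨k, not_le.1 hkn⟩ (hcon.trans_le (h1 _))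
          linarith
        have e1 := tail_succ_add (K := K) (α := t) ⟨k, not_le.1 hkn⟩
        have e2 := tail_succ_add (K := K) (α := t') ⟨k, not_le.1 hkn⟩
        have e3 := mul_le_mul_of_nonneg_left htt (hK.q_pos ⟨k, not_le.1 hkn⟩).le
        simp only at e1 e2
        linarith
    have := hall (max i n) (le_max_left _ _)
    rw [tail_of_le (le_max_right _ _), tail_of_le (le_max_right _ _)] at this
    exact lt_irrefl _ this
  have htail (i : ℕ) : K.tail t i = K.tail t' i := by
    induction i using Nat.strong_induction_on with
    | _ i ih =>
      exact le_antisymm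
        (not_lt.1 (key t t' h0 h1 h0' h1' (fun j => (h j).1) (fun j => (h' j).2) i ih))
        (not_lt.1 (key t' t h0' h1' h0 h1 (fun j => (h' j).1) (fun j => (h j).2) i
          fun k hk => (ih k hk).symm))
  funext j
  have e1 := tail_succ_add (K := K) (α := t) j
  have e2 := tail_succ_add (K := K) (α := t') j
  rw [htail, htail, e2] at e1
  exact (mul_left_cancel₀ (hK.q_pos j).ne' (add_right_cancel e1)).symm

end Market
end

/-! ### Optimality of the parity classes and conclusion -/

noncomputable section
namespace Market

variable {n : ℕ} {K : Market n} {M : ℕ}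

lemma mem_oddNodes {a : Fin M} : a ∈ oddNodes M ↔ Odd ((a : ℕ) + 1) := by simp [oddNodes]

lemma mem_evenNodes {a : Fin M} : a ∈ evenNodes M ↔ a ∉ oddNodes M := by
  simp [oddNodes, evenNodes]

lemma isIndepSet_oddNodes : (SimpleGraph.pathGraph M).IsIndepSet (oddNodes M : Set (Fin M)) := by
  intro a ha b hb _ hab
  rw [Finset.mem_coe, mem_oddNodes] at ha hb
  rw [SimpleGraph.pathGraph_adj] at hab
  grind

lemma isIndepSet_evenNodes : (SimpleGraph.pathGraph M).IsIndepSet (evenNodes M : Set (Fin M)) := by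
  intro a ha b hb _ hab
  rw [Finset.mem_coe, mem_evenNodes, mem_oddNodes] at ha hb
  rw [SimpleGraph.pathGraph_adj] at hab
  grind

section Counting

variable {I : Finset (Fin M)} (hI : (SimpleGraph.pathGraph M).IsIndepSet (I : Set (Fin M)))
include hI

lemma not_succ_mem {a b : Fin M} (ha : a ∈ I) (hb : b ∈ I) : (a : ℕ) + 1 ≠ b := by
  intro h
  have hadj : (SimpleGraph.pathGraph M).Adj a b := SimpleGraph.pathGraph_adj.2 (Or.inl h)
  exact hI ha hb hadj.ne hadj

/-- The blocks of indices `{0, 1}, {2, 3}, …` contain at most one element of `I` each, and each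
starts with an odd-numbered node. -/
lemma card_le_card_oddNodes : I.card ≤ (oddNodes M).card := by
  refine Finset.card_le_card_of_injOn
    (fun a => ⟨2 * ((a : ℕ) / 2), by have := a.2; omega⟩) (fun a _ => ?_) ?_
  · rw [Finset.mem_coe, mem_oddNodes]
    exact ⟨(a : ℕ) / 2, rfl⟩
  · intro a ha b hb hab
    have h1 := not_succ_mem hI ha hb
    have h2 := not_succ_mem hI hb ha
    have h3 := Fin.mk.inj_iff.1 hab
    exact Fin.ext (by omega)

/-- Indices up to `b` are paired as `{0, 1}, …, {b - 1, b}`. Since `b + 1` is not in `I`, the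
pairing can restart at `{b + 2, b + 3}`. Every pair that is used then contains an even-numbered node
of the path, even when the last pair is cut off. -/
lemma card_le_card_evenNodes {b : Fin M} (hb : b ∈ I) (hb' : b ∈ evenNodes M) :
    I.card ≤ (evenNodes M).card := by
  have hodd : (b : ℕ) % 2 = 1 := by
    rw [mem_evenNodes, mem_oddNodes] at hb'
    grind
  have hnot (a : Fin M) (ha : a ∈ I) : (a : ℕ) ≤ b ∨ (b : ℕ) + 2 ≤ a := by
    have := not_succ_mem hI hb ha
    omega
  have hlt (a : Fin M) (ha : a ∈ I) :
      (if (a : ℕ) ≤ b then 2 * ((a : ℕ) / 2) + 1 else 2 * (((a : ℕ) - 1) / 2) + 1) < M := by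
    have := hnot a ha
    have := a.2
    have := b.2
    split_ifs <;> omega
  refine Finset.card_le_card_of_injOn (fun a => if ha : a ∈ I then ⟨_, hlt a ha⟩ else b)
    (fun a ha => ?_) ?_
  · rw [Finset.mem_coe] at ha
    simp only [dif_pos ha, Finset.mem_coe, mem_evenNodes, mem_oddNodes]
    split_ifs <;> grind
  · intro a ha a' ha' haa
    rw [Finset.mem_coe] at ha ha'
    simp only [dif_pos ha, dif_pos ha', Fin.mk.injEq] at haa
    have h1 := not_succ_mem hI ha ha'
    have h2 := not_succ_mem hI ha' ha
    have h3 := hnot a ha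
    have h4 := hnot a' ha'
    refine Fin.ext ?_
    split_ifs at haa <;> omega

/-- The two classes of nodes are the best independent sets when the value of a node depends only
on its class. -/
lemma sum_le_max {u : Fin M → ℝ} {x y : ℝ} (hx : 0 ≤ x) (hy : 0 ≤ y)
    (hux : ∀ a ∈ oddNodes M, u a = x) (huy : ∀ a ∈ evenNodes M, u a = y) :
    ∑ a ∈ I, u a ≤ max ((oddNodes M).card * x) ((evenNodes M).card * y) := by
  have h1 : ∑ a ∈ I with a ∈ oddNodes M, u a = (I.filter (· ∈ oddNodes M)).card * x := by
    rw [Finset.sum_congr rfl fun a ha => hux a (Finset.mem_filter.1 ha).2, Finset.sum_const,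
      nsmul_eq_mul]
  have h2 : ∑ a ∈ I with a ∉ oddNodes M, u a = (I.filter (· ∉ oddNodes M)).card * y := by
    rw [Finset.sum_congr rfl fun a ha => huy a (mem_evenNodes.2 (Finset.mem_filter.1 ha).2),
      Finset.sum_const, nsmul_eq_mul]
  have hcard : ((I.filter (· ∈ oddNodes M)).card : ℝ) + (I.filter (· ∉ oddNodes M)).card
      = I.card := by
    exact_mod_cast Finset.card_filter_add_card_filter_not (s := I) (· ∈ oddNodes M)
  have hodd : (I.card : ℝ) ≤ (oddNodes M).card := by exact_mod_cast card_le_card_oddNodes hI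
  rw [← Finset.sum_filter_add_sum_filter_not I (· ∈ oddNodes M), h1, h2]
  rcases (I.filter (· ∉ oddNodes M)).eq_empty_or_nonempty with he | ⟨b, hb⟩
  · rw [he] at hcard ⊢
    simp only [Finset.card_empty, Nat.cast_zero, add_zero, zero_mul] at hcard ⊢
    rw [hcard]
    exact le_max_of_le_left (mul_le_mul_of_nonneg_right hodd hx)
  · rw [Finset.mem_filter] at hb
    have heven : (I.card : ℝ) ≤ (evenNodes M).card := by
      exact_mod_cast card_le_card_evenNodes hI hb.1 (mem_evenNodes.2 hb.2)
    rcases le_total x y with hxy | hxy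
    · refine le_max_of_le_right (le_trans ?_ (mul_le_mul_of_nonneg_right heven hy))
      rw [← hcard, add_mul]
      gcongr
    · refine le_max_of_le_left (le_trans ?_ (mul_le_mul_of_nonneg_right hodd hx))
      rw [← hcard, add_mul]
      gcongr

end Counting

/-- The probabilities with which the nodes are offered when the odd nodes are selected with the
probabilities `t`. -/
def classProb (t : Fin n → ℝ) (a : Fin M) : Fin n → ℝ :=
  if a ∈ oddNodes M then t else fun j => 1 - t j

lemma classProb_odd (t : Fin n → ℝ) {a : Fin M} (ha : a ∈ oddNodes M) : classProb t a = t :=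
  if_pos ha

lemma classProb_even (t : Fin n → ℝ) {a : Fin M} (ha : a ∈ evenNodes M) :
    classProb t a = fun j => 1 - t j := if_neg (mem_evenNodes.1 ha)

lemma oddNodes_ne_evenNodes (hM : 0 < M) : oddNodes M ≠ evenNodes M := by
  intro h
  have h0 : (⟨0, hM⟩ : Fin M) ∈ oddNodes M := by rw [mem_oddNodes]; simp
  have h1 := h0
  rw [h, mem_evenNodes] at h1
  exact h1 h0

lemma StateStrategy.select_oddNodes_add (hM : 0 < M) {j : Fin n}
    (ψ : K.StateStrategy (SimpleGraph.pathGraph M) j)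
    (h : ∀ I, ψ.select I ≠ 0 → I = oddNodes M ∨ I = evenNodes M) :
    ψ.select (oddNodes M) + ψ.select (evenNodes M) = 1 := by
  rw [← Finset.sum_pair (oddNodes_ne_evenNodes hM), ← ψ.select_sum]
  refine Finset.sum_subset (Finset.subset_univ _) fun I _ hI => ?_
  by_contra hne
  exact hI (by simpa using h I hne)

lemma StateStrategy.nodeProb_eq (hM : 0 < M) {j : Fin n}
    (ψ : K.StateStrategy (SimpleGraph.pathGraph M) j)
    (h : ∀ I, ψ.select I ≠ 0 → I = oddNodes M ∨ I = evenNodes M) (a : Fin M) :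
    ψ.nodeProb a
      = if a ∈ oddNodes M then ψ.select (oddNodes M) else 1 - ψ.select (oddNodes M) := by
  have hsum := ψ.select_oddNodes_add hM h
  unfold nodeProb
  split_ifs with ha
  · refine Finset.sum_eq_single_of_mem _ (by simpa using ha) fun I hI hne => ?_
    by_contra h0
    rcases h I h0 with rfl | rfl
    · exact hne rfl
    · exact mem_evenNodes.1 (Finset.mem_filter.1 hI).2 ha
  · rw [← hsum, add_sub_cancel_left]
    refine Finset.sum_eq_single_of_mem _ (by simpa using mem_evenNodes.2 ha) fun I hI hne => ?_
    by_contra h0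
    rcases h I h0 with rfl | rfl
    · exact ha (Finset.mem_filter.1 hI).2
    · exact hne rfl

lemma sum_value_odd (t : Fin n → ℝ) (j : Fin n) :
    ∑ a ∈ oddNodes M, K.value (K.tail (classProb t a)) j
      = (oddNodes M).card * K.value (K.tail t) j := by
  rw [Finset.sum_congr rfl fun a ha => by rw [classProb_odd t ha], Finset.sum_const, nsmul_eq_mul]

lemma sum_value_even (t : Fin n → ℝ) (j : Fin n) :
    ∑ a ∈ evenNodes M, K.value (K.tail (classProb t a)) j
      = (evenNodes M).card * K.value (K.tail fun j => 1 - t j) j := by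
  rw [Finset.sum_congr rfl fun a ha => by rw [classProb_even t ha], Finset.sum_const, nsmul_eq_mul]

lemma advantage_eq_sub (t : Fin n → ℝ) (j : Fin n) :
    K.advantage (oddNodes M).card (evenNodes M).card (K.tail t) j
      = ∑ a ∈ oddNodes M, K.value (K.tail (classProb t a)) j
        - ∑ a ∈ evenNodes M, K.value (K.tail (classProb t a)) j := by
  rw [sum_value_odd, sum_value_even, tail_one_sub, advantage]

/-- The structure of the symmetric equilibria on a path. -/
lemma IsSymmetricNE.select_and_balanced (hK : K.Admissible) {S : K.Profile (SimpleGraph.pathGraph M)}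
    (hS : IsSymmetricNE S) {T : K.Strategy (SimpleGraph.pathGraph M)} (hT : ∀ k, S k = T) :
    (∀ j I, (T j).select I ≠ 0 → I = oddNodes M ∨ I = evenNodes M) ∧
    (∃ U : Fin M → Fin n → ℝ, ∀ a,
      NodeEq K (fun j => (T j).nodeProb a) (fun j => (T j).penalty a) (U a)) ∧
    (0 < M → ∀ j, (0 < (T j).select (oddNodes M) → 0 ≤ K.advantage (oddNodes M).card
        (evenNodes M).card (K.tail fun j => (T j).select (oddNodes M)) j) ∧
      ((T j).select (oddNodes M) < 1 → K.advantage (oddNodes M).card (evenNodes M).card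
        (K.tail fun j => (T j).select (oddNodes M)) j ≤ 0)) := by
  obtain ⟨U, hU, hopt⟩ := hS.exists_nodeEq hK hT
  have hsel (j : Fin n) (I : Finset (Fin M)) (hI : (T j).select I ≠ 0) :
      I = oddNodes M ∨ I = evenNodes M :=
    eq_oddNodes_or_eq_evenNodes ((T j).select_indep I hI)
      (mem_or_mem_of_select_ne_zero hK hU hopt j I hI)
  refine ⟨hsel, ⟨U, hU⟩, fun hM j => ?_⟩
  set t : Fin n → ℝ := fun j => (T j).select (oddNodes M) with ht
  have hprob (a : Fin M) : (fun j => (T j).nodeProb a) = classProb t a := by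
    funext j
    rw [(T j).nodeProb_eq hM (hsel j), classProb]
    split_ifs <;> rfl
  have hval (a : Fin M) : U a = K.value (K.tail (classProb t a)) := by
    rw [← hprob]; exact (hU a).U_eq_value hK
  rw [advantage_eq_sub]
  simp only [← hval]
  constructor
  · intro h
    exact sub_nonneg.2 (hopt j _ h.ne' _ isIndepSet_evenNodes)
  · intro h
    have hsum := (T j).select_oddNodes_add hM (hsel j)
    refine sub_nonpos.2 (hopt j _ ?_ _ isIndepSet_oddNodes)
    intro h0
    rw [h0, add_zero] at hsum
    exact h.ne hsum

/-- Both equilibria solve the balance conditions, so they select odd nodes equally often. The node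
probabilities then agree, and uniqueness at each node gives the penalties. -/
lemma IsSymmetricNE.same (hK : K.Admissible) {S S' : K.Profile (SimpleGraph.pathGraph M)}
    (hS : IsSymmetricNE S) (hS' : IsSymmetricNE S') (i : Fin K.l) :
    Strategy.Same (S i) (S' i) := by
  obtain ⟨hsel, ⟨U, hU⟩, hbal⟩ := hS.select_and_balanced hK (T := S i) fun k => hS.2 k i
  obtain ⟨hsel', ⟨U', hU'⟩, hbal'⟩ := hS'.select_and_balanced hK (T := S' i) fun k => hS'.2 k i
  have hselect (j : Fin n) : (S i j).select = (S' i j).select := by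
    rcases Nat.eq_zero_or_pos M with rfl | hM
    · funext I
      have h1 := (S i j).select_sum
      have h2 := (S' i j).select_sum
      rw [Fintype.sum_eq_single I fun J hJ => absurd (Subsingleton.elim J I) hJ] at h1 h2
      rw [h1, h2]
    · have hle {T : K.Strategy (SimpleGraph.pathGraph M)}
          (h : ∀ j I, (T j).select I ≠ 0 → I = oddNodes M ∨ I = evenNodes M) (j : Fin n) :
          (T j).select (oddNodes M) ≤ 1 := by
        have h1 := (T j).select_oddNodes_add hM (h j)
        have h2 := (T j).select_nonneg (evenNodes M)
        linarith
      have ht := balanced_unique hK (k₁ := (oddNodes M).card) (k₂ := (evenNodes M).card)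
        (Finset.card_pos.2 ⟨⟨0, hM⟩, by rw [mem_oddNodes]; simp⟩)
        (fun j => (S i j).select_nonneg _) (hle hsel) (fun j => (S' i j).select_nonneg _)
        (hle hsel') (hbal hM) (hbal' hM)
      have htj : (S i j).select (oddNodes M) = (S' i j).select (oddNodes M) := congrFun ht j
      funext I
      by_cases hIo : I = oddNodes M
      · rw [hIo, htj]
      by_cases hIe : I = evenNodes M
      · have h1 := (S i j).select_oddNodes_add hM (hsel j)
        have h2 := (S' i j).select_oddNodes_add hM (hsel' j)
        rw [hIe]
        linarith
      · have h1 : (S i j).select I = 0 := by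
          by_contra h
          exact (hsel j I h).elim hIo hIe
        have h2 : (S' i j).select I = 0 := by
          by_contra h
          exact (hsel' j I h).elim hIo hIe
        rw [h1, h2]
  have hprob (a : Fin M) : (fun j => (S' i j).nodeProb a) = fun j => (S i j).nodeProb a := by
    funext j
    rw [StateStrategy.nodeProb, StateStrategy.nodeProb, hselect]
  refine fun j => ⟨hselect j, fun a ha => ?_⟩
  have h' := hU' a
  rw [hprob] at h'
  exact (hU a).penalty_eq hK h' ha

/-- Selecting the odd nodes with probability `t` and the even nodes with probability `1 - t`. -/
def classStrategy (hK : K.Admissible) (j : Fin n) (t : ℝ) (h0 : 0 ≤ t) (h1 : t ≤ 1)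
    (μ : Fin M → ProbabilityMeasure ℝ)
    (hμ : ∀ a, ∀ᵐ x ∂(μ a : Measure ℝ), x ∈ K.penalties j ∧ x ≤ K.v ∧ K.c < K.f j x) :
    K.StateStrategy (SimpleGraph.pathGraph M) j where
  -- The sum form keeps total mass `1` when `M = 0` and the two classes coincide.
  select := fun I => (if I = oddNodes M then t else 0) + if I = evenNodes M then 1 - t else 0
  select_nonneg := fun I => by
    refine add_nonneg ?_ ?_ <;> split_ifs <;> linarith
  select_sum := by simp [Finset.sum_add_distrib]
  select_indep := fun I hI => by
    by_cases ho : I = oddNodes M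
    · rw [ho]; exact isIndepSet_oddNodes
    · by_cases he : I = evenNodes M
      · rw [he]; exact isIndepSet_evenNodes
      · simp [ho, he] at hI
  penalty := μ
  penalty_mem := fun a => (hμ a).mono fun _ hx => hx.1
  integrable := fun a => hK.integrableOn_f j (μ a) (hμ a)

/-- A symmetric equilibrium on the path, with only the two classes of nodes selected. -/
theorem exists_isSymmetricNE (hK : K.Admissible) (M : ℕ) :
    ∃ S : K.Profile (SimpleGraph.pathGraph M), IsSymmetricNE S := by
  obtain ⟨t, h0, h1, hbal⟩ := exists_balanced hK (oddNodes M).card (evenNodes M).card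
  have hα0 (a : Fin M) (j : Fin n) : 0 ≤ classProb t a j := by
    unfold classProb; split_ifs
    · exact h0 j
    · exact sub_nonneg.2 (h1 j)
  have hα1 (a : Fin M) (j : Fin n) : classProb t a j ≤ 1 := by
    unfold classProb; split_ifs
    · exact h1 j
    · exact sub_le_self _ (h0 j)
  choose μ hμ hmem using fun a : Fin M => exists_nodeEq hK (hα0 a) (hα1 a)
  set T : K.Strategy (SimpleGraph.pathGraph M) := fun j =>
    classStrategy hK j (t j) (h0 j) (h1 j) (fun a => μ a j) (fun a => hmem a j) with hT
  have hprob (a : Fin M) : (fun j => (T j).nodeProb a) = classProb t a := by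
    funext j
    have hi := mem_evenNodes (a := a)
    simp only [StateStrategy.nodeProb, hT, classStrategy, Finset.sum_add_distrib,
      Finset.sum_ite_eq', Finset.mem_filter_univ, classProb, hi]
    by_cases ha : a ∈ oddNodes M <;> simp [ha]
  have hpos (a : Fin M) (j : Fin n) := (hμ a).U_pos hK j
  refine ⟨fun _ => T, isSymmetricNE_const hK T (fun a => K.value (K.tail (classProb t a)))
    (fun a => by rw [hprob]; exact hμ a)
    (fun j => max (∑ a ∈ oddNodes M, K.value (K.tail (classProb t a)) j)
      (∑ a ∈ evenNodes M, K.value (K.tail (classProb t a)) j)) (fun j I hI => ?_)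
    fun j I hI => ?_⟩
  · rw [sum_value_odd, sum_value_even]
    refine sum_le_max hI ?_ ?_ (fun a ha => by rw [classProb_odd t ha])
      fun a ha => by rw [classProb_even t ha]
    · exact (IsLoad.value_pos hK (isLoad_tail hK h0 h1) j).le
    · exact (IsLoad.value_pos hK (isLoad_tail hK (fun j => sub_nonneg.2 (h1 j))
        fun j => sub_le_self _ (h0 j)) j).le
  · have hb := hbal j
    rw [advantage_eq_sub, sub_nonneg, sub_nonpos] at hb
    have hI' : (if I = oddNodes M then t j else 0) + (if I = evenNodes M then 1 - t j else 0) ≠ 0 :=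
      hI
    rcases (em (I = oddNodes M ∧ t j ≠ 0)) with ⟨rfl, ht⟩ | hno
    · exact (max_eq_left (hb.1 ((h0 j).lt_of_ne' ht))).symm
    · have h2 : (if I = oddNodes M then t j else 0) = 0 := by
        split_ifs with h
        · by_contra ht; exact hno ⟨h, ht⟩
        · rfl
      rw [h2, zero_add] at hI'
      have h3 : I = evenNodes M := by
        by_contra h; simp [h] at hI'
      rw [if_pos h3] at hI'
      rw [h3]
      refine (max_eq_right (hb.2 ((h1 j).lt_of_ne fun h => ?_))).symm
      exact hI' (by rw [h, sub_self])

end Market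
end

theorem mainTheorem5 {n : ℕ} (K : Market n) (hK : K.Admissible) (M : ℕ) :
    ∃ S : K.Profile (SimpleGraph.pathGraph M),
      Market.IsSymmetricNE S ∧
      (∀ S' : K.Profile (SimpleGraph.pathGraph M), Market.IsSymmetricNE S' →
        ∀ i, Market.Strategy.Same (S i) (S' i)) ∧
      ∀ (i : Fin K.l) (j : Fin n) (I : Finset (Fin M)),
        (S i j).select I ≠ 0 → I = oddNodes M ∨ I = evenNodes M := by
  obtain ⟨S, hS⟩ := Market.exists_isSymmetricNE hK M
  exact ⟨S, hS, fun S' hS' i => hS.same hK hS' i,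
    fun i => (hS.select_and_balanced hK (T := S i) fun k => hS.2 k i).1⟩
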